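/- Let $m,s,n,k$ be positive integers with $m+s=n+k$. A partition is a nonincreasing finite sequence of integers. Let $\mathbf a=(a_1,\dots,a_s)$, $\mathbf d=(d_1,\dots,d_m)$, $\mathbf b=(b_1,\dots,b_k)$, $\mathbf c=(c_1,\dots,c_n)$ be partitions with $c_i\neq d_j$ for all $i,j$. For a sequence $y_1,\dots,y_w$ put $y_i=+\infty$ for $i\le 0$ and $y_i=-\infty$ for $i>w$; empty sums are $0$. **Generalized majorization.** For a partition $\mathbf g=(g_1,\dots,g_{m+s})$ write $\mathbf g\prec'(\mathbf d,\mathbf a)$ if (1) $d_i\ge g_{i+s}$ for $i=1,\dots,m$; (2) $\sum_{i=1}^{h_j}g_i-\sum_{i=1}^{h_j-j}d_i\le\sum_{i=1}^{j}a_i$ for $j=1,\dots,s$, where $h_j=\min\{i\mid d_{i-j+1}<g_i\}$; (3) $\sum_{i=1}^{m+s}g_i=\sum_{i=1}^m d_i+\sum_{i=1}^s a_i$. The relation $\mathbf g\prec'(\mathbf c,\mathbf b)$ is defined in the same way. **Unions.** Let $\mathbf e=(e_1,\dots,e_{m+s})$ be the union of $\mathbf d$ and $\mathbf a$ in nonincreasing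 order, where an entry of $\mathbf a$ stands before an equal entry of $\mathbf d$; let $\mathbf e'=(e'_1,\dots,e'_{m+s})$ be the union of $\mathbf c$ and $\mathbf b$ in nonincreasing order, where an entry of $\mathbf b$ stands before an equal entry of $\mathbf c$. **The sets $S\subseteq\{1,\dots,n\}$ and $\Delta\subseteq\{1,\dots,m\}$.** Start with $S=\Delta=\emptyset$ and go through all the entries of $\mathbf c$ and $\mathbf d$ from the smallest to the largest, equal entries in the order of decreasing indices. If the current entry is $d_j$, let (with the current $S$ and $\Delta$) $$q_j=s-\#\{i\in S\mid c_i<d_j\}+\#\{i>j\mid i\notin\Delta\}+1.$$ If $q_j>s$, put $j$ into $\Delta$. If $q_j\le s$, let $l\in S$ be the minimal index with $d_j>c_l$ and let $\mu=\#\{i\mid a_i>c_l\}$, $\tau=s-\#\{i\in S\mid i>l\}+\#\{i\notin\Delta\mid d_i<c_l\}$. (a) If $\mu\ge\tau$ and $d_j$ belongs to the smallest $\mu-\tau+1$ of the $e_i$'s bigger than $c_l$, do not put $j$ into $\Delta$. (b) Otherwise, put $j$ into $\Delta$ if and only if the inequality $$\sum_{i\in S,\ c_i<d_j}c_i\ \ge\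 \sum_{i\notin\Delta,\ i>j}d_i+d_j+\sum_{i=q_j+1}^{s}a_i$$ fails. If the current entry is $c_j$, decide whether $j$ is put into $S$ by the dual rule, obtained by exchanging $(\mathbf d,\mathbf a,\mathbf e,m,s,\Delta)$ with $(\mathbf c,\mathbf b,\mathbf e',n,k,S)$. **Further notation.** After the construction is complete, let $h=\#\Delta$, $h'=\#S$; let $d^1\ge\dots\ge d^h$ be the $d_i$ with $i\in\Delta$ and $c^1\ge\dots\ge c^{h'}$ the $c_i$ with $i\in S$. For $y=1,\dots,h'$ put $m_y=\#\{i\mid a_i>c^y\}$, $t_y=s-(h'-y)+\#\{i\notin\Delta\mid d_i<c^y\}$, $z_y=\#\{i\mid d_i>c^y\}$, and for $x=1,\dots,h$ put $m'_x=\#\{i\mid b_i>d^x\}$, $t'_x=k-(h-x)+\#\{i\notin S\mid c_i<d^x\}$, $z'_x=\#\{i\mid c_i>d^x\}$. **Theorem.** There is a partition $\mathbf g=(g_1,\dots,g_{m+s})$ with $\mathbf g\prec'(\mathbf d,\mathbf a)$ and $\mathbf g\prec'(\mathbf c,\mathbf b)$ if and only if $$\sum_{i=1}^n c_i+\sum_{i=1}^k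 b_i=\sum_{i=1}^m d_i+\sum_{i=1}^s a_i$$ and the following two conditions hold: (i) for every $y\in\{1,\dots,h'\}$ with $t_y\le m_y$, $$\sum_{i=z_y+t_y}^{z_y+m_y}e_i\le\sum_{i=y}^{h'}c^i-\sum_{i\ge z_y+1,\ i\notin\Delta}d_i-\sum_{i=m_y+1}^{s}a_i;$$ (ii) for every $x\in\{1,\dots,h\}$ with $t'_x\le m'_x$, $$\sum_{i=z'_x+t'_x}^{z'_x+m'_x}e'_i\le\sum_{i=x}^{h}d^i-\sum_{i\ge z'_x+1,\ i\notin S}c_i-\sum_{i=m'_x+1}^{k}b_i.$$ -/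

import Mathlib

/-
Finite sequences of integers `x₁, …, x_N` are functions `x : Fin N → ℤ`; the entry `x i` is the
entry with the one-based index `i + 1`.  A partition is such a sequence which is
nonincreasing, i.e. `Antitone x`.  The integer arguments `i, j, r, t, …` of the functions
`ext`, `psum` and `extSum` below are one-based.
-/

namespace PartitionPairs

/-- The entry `x_i` (one-based), with the conventions `x_i = +∞` for `i ≤ 0` and `x_i = -∞` for
`i > N`. -/
def ext {N : ℕ} (x : Fin N → ℤ) (i : ℤ) : WithBot (WithTop ℤ) :=
  if i ≤ 0 then ⊤
  else if h : (i - 1).toNat < N then (((x ⟨(i - 1).toNat, h⟩ : ℤ) : WithTop ℤ) : WithBot (WithTop ℤ))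
  else ⊥

/-- The sum `∑_{i=r}^t x_i` (one-based indices) for `1 ≤ r`, `t ≤ N`; it is `0` if `r > t`. -/
def psum {N : ℕ} (x : Fin N → ℤ) (r t : ℤ) : ℤ :=
  ∑ i ∈ Finset.univ.filter (fun i : Fin N => r ≤ ((i : ℕ) : ℤ) + 1 ∧ ((i : ℕ) : ℤ) + 1 ≤ t), x i

/-- The sum `∑_{i=r}^t x_i` (one-based indices) for `t ≤ N`, with the conventions that the sum is
`0` if `r > t` and that `x_i = +∞` for `i ≤ 0`. -/
def extSum {N : ℕ} (x : Fin N → ℤ) (r t : ℤ) : WithTop ℤ :=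
  if r ≤ 0 ∧ r ≤ t then ⊤ else ((psum x r t : ℤ) : WithTop ℤ)

/-! ### Generalized majorization -/

/-- `h_j = min {i | d_{i-j+1} < g_i}`.  For `j ≥ 1` only positive `i` qualify (as `g_i = +∞` for
`i ≤ 0`), and if `g` has at least `m + j` entries, the set contains `m + j`. -/
noncomputable def hIdx {N m : ℕ} (g : Fin N → ℤ) (d : Fin m → ℤ) (j : ℕ) : ℕ :=
  sInf {i : ℕ | ext d ((i : ℤ) - j + 1) < ext g i}

/-- The generalized majorization `g ≺' (d, a)`, for sequences `d`, `a`, `g` of lengths `m`, `s`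
and `N = m + s`. -/
structure GenMajorized {N m s : ℕ} (g : Fin N → ℤ) (d : Fin m → ℤ) (a : Fin s → ℤ) : Prop where
  length_eq : N = m + s
  le_entry : ∀ i : ℕ, 1 ≤ i → i ≤ m → ext g ((i : ℤ) + s) ≤ ext d i
  partial_sum : ∀ j : ℕ, 1 ≤ j → j ≤ s →
    psum g 1 (hIdx g d j) - psum d 1 ((hIdx g d j : ℤ) - j) ≤ psum a 1 j
  total_sum : ∑ i, g i = ∑ i, d i + ∑ i, a i

/-! ### Unions of partitions -/

/-- The permutation which arranges the joint sequence `(x₁, …, x_M, y₁, …, y_N)` in nonincreasing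
order.  The sorting is stable: equal entries keep their order, so an entry of `x` stands before an
equal entry of `y`, and equal entries of `x` (or of `y`) are ordered by their indices. -/
def unionPerm {M N : ℕ} (x : Fin M → ℤ) (y : Fin N → ℤ) : Equiv.Perm (Fin (M + N)) :=
  Tuple.sort (fun i => OrderDual.toDual (Fin.append x y i))

/-- The union of two partitions, arranged in nonincreasing order. -/
def union {M N : ℕ} (x : Fin M → ℤ) (y : Fin N → ℤ) : Fin (M + N) → ℤ :=
  fun i => Fin.append x y (unionPerm x y i)

/-- "`d_j` belongs to the smallest `K` of the `e_i`'s bigger than `v`", where `e` is the union of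
`d` and `a`, in which an entry of `a` stands before an equal entry of `d`.  If `P` is the number of
the `e_i`'s bigger than `v`, these are `e₁, …, e_P`, and the smallest `K` of them are those with
(one-based) index `> P - K`. -/
def AmongSmallest {m s : ℕ} (d : Fin m → ℤ) (a : Fin s → ℤ) (j : Fin m) (v K : ℤ) : Prop :=
  v < d j ∧
    ((Finset.univ.filter fun i => v < union a d i).card : ℤ) - K <
      (((unionPerm a d).symm (Fin.natAdd s j) : ℕ) : ℤ) + 1

/-! ### The sets `S` and `Δ`

All definitions are given for the elements of `d` (with the current sets `Δ` and `S`).  Those for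
the elements of `c` are the same with `d, a, Δ` and `c, b, S` exchanged. -/

section Rule

variable {m s n : ℕ} (d : Fin m → ℤ) (a : Fin s → ℤ) (c : Fin n → ℤ)
  (Δ : Finset (Fin m)) (S : Finset (Fin n))

/-- `q_j = s - #{i ∈ S | c_i < d_j} + #{i > j | i ∉ Δ} + 1`. -/
def qIdx (j : Fin m) : ℤ :=
  (s : ℤ) - (S.filter fun i => c i < d j).card
    + (Finset.univ.filter fun i => j < i ∧ i ∉ Δ).card + 1

/-- `#{i | a_i > c_l}`. -/
def mIdx (l : Fin n) : ℤ := (Finset.univ.filter fun i => c l < a i).card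

/-- `s - #{i ∈ S | i > l} + #{i ∉ Δ | d_i < c_l}`. -/
def tIdx (l : Fin n) : ℤ :=
  (s : ℤ) - (S.filter fun i => l < i).card
    + (Finset.univ.filter fun i => i ∉ Δ ∧ d i < c l).card

/-- `#{i | d_i > c_l}`. -/
def zIdx (l : Fin n) : ℤ := (Finset.univ.filter fun i => c l < d i).card

/-- Condition (a) of the rule for `d_j`, where `l ∈ S` is the minimal index with `c_l < d_j`. -/
def CondA (j : Fin m) : Prop :=
  ∃ l ∈ S, c l < d j ∧ (∀ i ∈ S, c i < d j → l ≤ i) ∧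
    tIdx (s := s) d c Δ S l ≤ mIdx a c l ∧
    AmongSmallest d a j (c l) (mIdx a c l - tIdx (s := s) d c Δ S l + 1)

/-- The inequality in (b) of the rule for `d_j`:
`∑_{c_i < d_j, i ∈ S} c_i ≥ ∑_{i ∉ Δ, i > j} d_i + d_j + ∑_{i = q_j + 1}^s a_i`. -/
def CondB (j : Fin m) : Prop :=
  ((((∑ i with i ∉ Δ ∧ j < i, d i) + d j : ℤ)) : WithTop ℤ)
      + extSum a (qIdx (s := s) d c Δ S j + 1) s
    ≤ ((∑ i ∈ S with c i < d j, c i : ℤ) : WithTop ℤ)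

/-- The outcome of the rule for `d_j`: whether `j` is put into `Δ`. -/
def Chosen (j : Fin m) : Prop :=
  (s : ℤ) < qIdx (s := s) d c Δ S j ∨ (¬ CondA d a c Δ S j ∧ ¬ CondB d a c Δ S j)

end Rule

section Sets

variable {m s n k : ℕ} (d : Fin m → ℤ) (a : Fin s → ℤ) (c : Fin n → ℤ) (b : Fin k → ℤ)

open Classical in
/-- One step of the construction of `(Δ, S)`.  The chosen element is an entry of the joint sequence
`(d₁, …, d_m, c₁, …, c_n)`. -/
noncomputable def stepSets (x : Fin (m + n)) (P : Finset (Fin m) × Finset (Fin n)) :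
    Finset (Fin m) × Finset (Fin n) :=
  Fin.addCases (motive := fun _ => Finset (Fin m) × Finset (Fin n))
    (fun j => if Chosen d a c P.1 P.2 j then (insert j P.1, P.2) else P)
    (fun j => if Chosen c b d P.2 P.1 j then (P.1, insert j P.2) else P) x

/-- The pair `(Δ, S)`.  Start with empty sets and go through the union `u` of `d` and `c` from its
last entry to its first one, that is, from the smallest entry to the largest, equal entries in
the order of decreasing indices. -/
noncomputable def sets : Finset (Fin m) × Finset (Fin n) :=
  (List.ofFn fun i => unionPerm d c i).foldr (stepSets d a c b) (∅, ∅)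

/-- The set `Δ`. -/
noncomputable def setΔ : Finset (Fin m) := (sets d a c b).1

/-- The set `S`. -/
noncomputable def setS : Finset (Fin n) := (sets d a c b).2

end Sets

/-! ### The conditions -/

/-- Condition (i): if `y ∈ {1, …, h'}` is such that `t_y ≤ m_y`, then
`∑_{i = z_y + t_y}^{z_y + m_y} e_i ≤ ∑_{i = y}^{h'} c^i - ∑_{i ≥ z_y + 1, i ∉ Δ} d_i
  - ∑_{i = m_y + 1}^s a_i`.
Here `c^1 ≥ ⋯ ≥ c^{h'}` are the `c_l` with `l ∈ S` and `e` is the union of `d` and `a`.  The index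
`y` is represented by the `y`-th element `l` of `S`, so that `c^y = c_l`, `h' - y` is the number of
the `i ∈ S` with `i > l`, and `c^y, …, c^{h'}` are the `c_i` with `i ∈ S` and `i ≥ l`. -/
def Cond {m s n : ℕ} (d : Fin m → ℤ) (a : Fin s → ℤ) (c : Fin n → ℤ)
    (Δ : Finset (Fin m)) (S : Finset (Fin n)) : Prop :=
  ∀ l ∈ S, tIdx (s := s) d c Δ S l ≤ mIdx a c l →
    extSum (union a d) (zIdx d c l + tIdx (s := s) d c Δ S l) (zIdx d c l + mIdx a c l) ≤
      (((∑ i ∈ S with l ≤ i, c i)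
        - (∑ i ∈ Finset.univ.filter (fun i : Fin m => zIdx d c l + 1 ≤ ((i : ℕ) : ℤ) + 1 ∧ i ∉ Δ), d i)
        - psum a (mIdx a c l + 1) s : ℤ) : WithTop ℤ)

end PartitionPairs

/-! Partitions are read from the bottom. Given the total sum, `g ≺' (d, a)` amounts to a condition
at every level `w`: the entries of `g` that are at most `w` have a sum no smaller than that of some
equally long choice from `d` and `a` which contains all entries of `d` up to `w`. This is `Covers d
a (cnt d w) (cnt g w) (lowSum g (cnt g w))`; see `GenMajorized.covers` and `genMajorized_of_covers`.

The sets `Δ` and `S` greedily collect a multiset `M` of small entries forced on every common `g`.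
Passing `d_j` obliges the choice to contain one more entry of `d`. The rule selects `d_j` exactly
when the present `M` fails this stronger demand (`Covers.chosen_iff`), and adding `d_j` then repairs
it for `(d, a)` (`Covers.insert_entry`). The addition could violate the demand of `(c, b)`; the
clause of (ii) at that entry says precisely that it does not (`cond_insert_iff`, via
`condAt_iff_covers`). Entries of `c` are treated dually.

Sufficiency: under (i) and (ii), `M` meets both demands at every level (`Run.feasible`), but may
have the wrong length or sum. Keep `M` up to a suitable `x` and fill up with entries `x` and `x + 1`
(`exists_flattened`). Only level `x` needs an argument, and there discrete convexity of the least
covering sum suffices (`Covers.interpolate`).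

Necessity: compare the tail functions `w ↦ ∑_{e ≤ w} (w - e)`. That of a common `g` stays above that
of `M` (`Run.dominated`). When `d_j` is forced, `g` has strictly more entries up to `d_j` than `M`,
and interpolating between `M` and `g` yields the clause at `d_j`. -/

namespace PartitionPairs

/-! ### Sums of the smallest entries of a partition -/

/-- The `i`-th smallest entry (zero-based) of a partition. -/
def low {N : ℕ} (x : Fin N → ℤ) (i : ℕ) : ℤ :=
  if h : i < N then x ⟨N - 1 - i, by omega⟩ else 0

/-- The sum of the `p` smallest entries of a partition. -/
def lowSum {N : ℕ} (x : Fin N → ℤ) (p : ℕ) : ℤ := ∑ i ∈ Finset.range p, low x i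

/-- The number of entries which are at most `w`. -/
def cnt {N : ℕ} (x : Fin N → ℤ) (w : ℤ) : ℕ := (Finset.univ.filter fun i => x i ≤ w).card

section Low

variable {N : ℕ} {x : Fin N → ℤ}

lemma low_apply (x : Fin N → ℤ) (j : Fin N) {p : ℕ} (h : (j : ℕ) + p + 1 = N) :
    low x p = x j := by
  have hp : p < N := by omega
  simp only [low, hp, dif_pos]
  congr 1
  ext
  simp
  omega

lemma low_mono (hx : Antitone x) {i j : ℕ} (hij : i ≤ j) (hj : j < N) : low x i ≤ low x j := by
  simp only [low, hj, lt_of_le_of_lt hij hj, dif_pos]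
  apply hx
  simp only [Fin.mk_le_mk]
  omega

lemma lowSum_zero (x : Fin N → ℤ) : lowSum x 0 = 0 := by simp [lowSum]

lemma lowSum_succ (x : Fin N → ℤ) (p : ℕ) : lowSum x (p + 1) = lowSum x p + low x p :=
  Finset.sum_range_succ _ _

lemma lowSum_eq (x : Fin N → ℤ) {p : ℕ} (hp : p ≤ N) :
    lowSum x p = ∑ i with N ≤ (i : Fin N).val + p, x i := by
  induction p with
  | zero =>
    rw [lowSum_zero, Finset.filter_false_of_mem, Finset.sum_empty]
    intro i _
    have := i.2
    omega
  | succ p ih =>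
    have hj : N - 1 - p < N := by omega
    have : (Finset.univ.filter fun i : Fin N => N ≤ i.val + (p + 1))
        = insert ⟨N - 1 - p, hj⟩ (Finset.univ.filter fun i : Fin N => N ≤ i.val + p) := by
      ext i
      simp only [Finset.mem_filter, Finset.mem_univ, true_and, Finset.mem_insert, Fin.ext_iff]
      omega
    rw [lowSum_succ, ih (by omega), this, Finset.sum_insert, add_comm,
      low_apply x ⟨N - 1 - p, hj⟩ (by simp only; omega)]
    simp only [Finset.mem_filter, Finset.mem_univ, true_and]
    omega

lemma lowSum_top (x : Fin N → ℤ) : lowSum x N = ∑ i, x i := by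
  rw [lowSum_eq x le_rfl]
  congr 1
  ext i
  simp

lemma card_upper {p : ℕ} (hp : p ≤ N) :
    (Finset.univ.filter fun i : Fin N => N ≤ i.val + p).card = p := by
  have := lowSum_eq (fun _ : Fin N => (1 : ℤ)) hp
  simp only [Finset.sum_const, nsmul_eq_mul, mul_one] at this
  have h2 : lowSum (fun _ : Fin N => (1 : ℤ)) p = p := by
    rw [lowSum, Finset.sum_congr rfl (g := fun _ => (1 : ℤ))]
    · simp
    · intro i hi
      have : i < N := by have := Finset.mem_range.1 hi; omega
      simp [low, this]
  rw [h2] at this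
  exact_mod_cast this.symm

lemma cnt_le (x : Fin N → ℤ) (w : ℤ) : cnt x w ≤ N :=
  (Finset.card_le_univ _).trans (by simp)

lemma cnt_mono (x : Fin N → ℤ) {v w : ℤ} (h : v ≤ w) : cnt x v ≤ cnt x w :=
  Finset.card_le_card fun i => by simp only [Finset.mem_filter, Finset.mem_univ, true_and]; omega

lemma le_iff_cnt (hx : Antitone x) (i : Fin N) (w : ℤ) : x i ≤ w ↔ N ≤ i.val + cnt x w := by
  constructor
  · intro h
    have : Finset.Ici i ⊆ Finset.univ.filter fun i => x i ≤ w := by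
      intro j hj
      simp only [Finset.mem_filter, Finset.mem_univ, true_and]
      exact (hx (Finset.mem_Ici.1 hj)).trans h
    have := Finset.card_le_card this
    rw [Fin.card_Ici] at this
    unfold cnt
    omega
  · intro h
    by_contra hw
    have : (Finset.univ.filter fun i => x i ≤ w) ⊆ Finset.Ioi i := by
      intro j hj
      simp only [Finset.mem_filter, Finset.mem_univ, true_and] at hj
      rw [Finset.mem_Ioi]
      by_contra hji
      exact hw ((hx (not_lt.1 hji)).trans hj)
    have := Finset.card_le_card this
    rw [Fin.card_Ioi] at this
    have := i.2
    unfold cnt at h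
    omega

lemma low_le_iff (hx : Antitone x) {p : ℕ} (hp : p < N) (w : ℤ) : low x p ≤ w ↔ p < cnt x w := by
  rw [low_apply x ⟨N - 1 - p, by omega⟩ (by simp only; omega), le_iff_cnt hx]
  simp only
  omega

lemma lowSum_cnt (hx : Antitone x) (w : ℤ) : lowSum x (cnt x w) = ∑ i with x i ≤ w, x i := by
  rw [lowSum_eq x (cnt_le x w)]
  congr 1
  ext i
  simp [le_iff_cnt hx]

lemma lowSum_card_le (hx : Antitone x) (X : Finset (Fin N)) :
    lowSum x X.card ≤ ∑ i ∈ X, x i := by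
  induction hk : X.card generalizing X with
  | zero =>
    rw [Finset.card_eq_zero.1 hk, Finset.sum_empty, lowSum_zero]
  | succ k ih =>
    have hne : X.Nonempty := by rw [← Finset.card_pos]; omega
    set i := X.min' hne with hi
    have him : i ∈ X := X.min'_mem hne
    have hsub : X ⊆ Finset.Ici i := fun j hj => Finset.mem_Ici.2 (X.min'_le j hj)
    have hc := Finset.card_le_card hsub
    rw [Fin.card_Ici, hk] at hc
    have h1 := ih (X.erase i) (by rw [Finset.card_erase_of_mem him]; omega)
    rw [lowSum_succ, ← Finset.sum_erase_add X x him]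
    have : low x k ≤ x i := by
      rw [low_apply x ⟨N - 1 - k, by omega⟩ (by simp only; omega)]
      apply hx
      rw [Fin.le_def]
      simp only
      omega
    omega

/-- The `k` entries after the `p` smallest ones, if they are at least `v`. -/
lemma lowSum_add_ge (hx : Antitone x) {p k : ℕ} {v : ℤ} (hpk : p + k ≤ N)
    (h : 0 < k → v ≤ low x p) : lowSum x p + k * v ≤ lowSum x (p + k) := by
  induction k with
  | zero => simp
  | succ k ih =>
    have h1 := ih (by omega) (fun _ => h (by omega))
    have h2 := low_mono hx (show p ≤ p + k by omega) (by omega)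
    have h3 := h (by omega)
    rw [← add_assoc, lowSum_succ]
    push_cast
    linarith

lemma lowSum_add_le (hx : Antitone x) {p k : ℕ} {v : ℤ} (hpk : p + k ≤ N)
    (h : 0 < k → low x (p + k - 1) ≤ v) : lowSum x (p + k) ≤ lowSum x p + k * v := by
  induction k with
  | zero => simp
  | succ k ih =>
    have h3 := h (by omega)
    have h1 := ih (by omega) (fun _ => (low_mono hx (by omega) (by omega)).trans h3)
    rw [← add_assoc, lowSum_succ]
    rw [← add_assoc, Nat.add_sub_cancel] at h3
    push_cast
    linarith

end Low

/-! ### Covering sums and their discrete convexity -/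

/-- `R` is at least the sum of the `r` smallest entries of the union of `d` and `a`, where the
`q` smallest entries of `d` have to be among the `r` entries. -/
def Covers {m s : ℕ} (d : Fin m → ℤ) (a : Fin s → ℤ) (q r : ℕ) (R : ℤ) : Prop :=
  ∃ p i : ℕ, q ≤ p ∧ p ≤ m ∧ i ≤ s ∧ p + i = r ∧ lowSum d p + lowSum a i ≤ R

section Covers

variable {m s : ℕ} {d : Fin m → ℤ} {a : Fin s → ℤ}

lemma Covers.mono {q q' r : ℕ} {R R' : ℤ} (h : Covers d a q r R) (hq : q' ≤ q) (hR : R ≤ R') :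
    Covers d a q' r R' := by
  obtain ⟨p, i, h1, h2, h3, h4, h5⟩ := h
  exact ⟨p, i, hq.trans h1, h2, h3, h4, h5.trans hR⟩

lemma Covers.le {q r : ℕ} {R : ℤ} (h : Covers d a q r R) : q ≤ r := by
  obtain ⟨p, i, h1, h2, h3, h4, h5⟩ := h
  omega

lemma Covers.le_length {q r : ℕ} {R : ℤ} (h : Covers d a q r R) : r ≤ m + s := by
  obtain ⟨p, i, h1, h2, h3, h4, h5⟩ := h
  omega

lemma covers_zero : Covers d a 0 0 0 :=
  ⟨0, 0, le_rfl, Nat.zero_le _, Nat.zero_le _, rfl, by simp [lowSum_zero]⟩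

lemma covers_top_iff {q : ℕ} (hq : q ≤ m) {R : ℤ} :
    Covers d a q (m + s) R ↔ ∑ i, d i + ∑ i, a i ≤ R := by
  constructor
  · rintro ⟨p, i, h1, h2, h3, h4, h5⟩
    obtain rfl : p = m := by omega
    obtain rfl : i = s := by omega
    rwa [lowSum_top, lowSum_top] at h5
  · intro h
    exact ⟨m, s, hq, le_rfl, le_rfl, rfl, by rwa [lowSum_top, lowSum_top]⟩

/-- Discrete convexity of the least `R` as a function of `r`. -/
lemma Covers.interpolate (hd : Antitone d) (ha : Antitone a) {q r₀ r r₁ : ℕ} {R₀ R R₁ x : ℤ}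
    (h₀ : Covers d a q r₀ R₀) (h₁ : Covers d a q r₁ R₁) (hr₀ : r₀ ≤ r) (hr₁ : r ≤ r₁)
    (hR₀ : R₀ + ((r : ℤ) - r₀) * x ≤ R) (hR₁ : R₁ ≤ R + ((r₁ : ℤ) - r) * (x + 1)) :
    Covers d a q r R := by
  obtain ⟨k, rfl⟩ := Nat.exists_eq_add_of_le hr₀
  induction k generalizing r₀ R₀ with
  | zero => exact h₀.mono le_rfl (by simpa using hR₀)
  | succ k ih =>
    push_cast at hR₀
    obtain ⟨p₀, i₀, hq, hp, hi, hs, hsum⟩ := h₀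
    -- Climb from the lower witness: any unused entry that is at most `x` may be added within the
    -- allowance of `x` per entry.
    by_cases hA : i₀ < s ∧ low a i₀ ≤ x
    · have := ih (r₀ := r₀ + 1) (R₀ := R₀ + x)
        ⟨p₀, i₀ + 1, hq, hp, hA.1, by omega, by rw [lowSum_succ]; linarith⟩
        (by omega) (by omega) (by push_cast; linarith)
        (by push_cast at hR₁ ⊢; linarith)
      convert this using 1
      omega
    by_cases hD : p₀ < m ∧ low d p₀ ≤ x
    · have := ih (r₀ := r₀ + 1) (R₀ := R₀ + x)
        ⟨p₀ + 1, i₀, by omega, hD.1, hi, by omega, by rw [lowSum_succ]; linarith⟩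
        (by omega) (by omega) (by push_cast; linarith)
        (by push_cast at hR₁ ⊢; linarith)
      convert this using 1
      omega
    -- Now all entries unused by the lower witness are at least `x + 1`. Descend from the upper
    -- witness instead: each removed entry lies outside the lower witness, so the sum drops by at
    -- least `x + 1`.
    push Not at hA hD
    clear hR₀ ih
    obtain ⟨t, rfl⟩ := Nat.exists_eq_add_of_le hr₁
    clear hr₁
    induction t generalizing R₁ with
    | zero => exact h₁.mono le_rfl (by simpa using hR₁)
    | succ t ih =>
      obtain ⟨p, i, hq', hp', hi', hs', hsum'⟩ := h₁
      push_cast at hR₁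
      by_cases hpp : p₀ < p
      · obtain ⟨p, rfl⟩ : ∃ p', p = p' + 1 := ⟨p - 1, by omega⟩
        have h1 := hD (by omega)
        have h2 := low_mono hd (show p₀ ≤ p by omega) (by omega)
        rw [lowSum_succ] at hsum'
        exact ih (R₁ := R₁ - (x + 1)) ⟨p, i, by omega, by omega, hi', by omega, by linarith⟩
          (by push_cast; linarith)
      · obtain ⟨i, rfl⟩ : ∃ i', i = i' + 1 := ⟨i - 1, by omega⟩
        have h1 := hA (by omega)
        have h2 := low_mono ha (show i₀ ≤ i by omega) (by omega)
        rw [lowSum_succ] at hsum'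
        exact ih (R₁ := R₁ - (x + 1)) ⟨p, i, by omega, by omega, by omega, by omega, by linarith⟩
          (by push_cast; linarith)

/-- A witness that does not serve for `q + 1` uses exactly the `q` smallest entries of `d`, so the
next one is still available. -/
lemma Covers.insert_entry {q r : ℕ} {R : ℤ} (hq : q < m) (h : Covers d a q r R)
    (h' : ¬ Covers d a (q + 1) r R) : Covers d a (q + 1) (r + 1) (R + low d q) := by
  obtain ⟨p, i, h1, h2, h3, h4, h5⟩ := h
  obtain rfl : p = q := by
    by_contra hne
    exact h' ⟨p, i, by omega, h2, h3, h4, h5⟩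
  exact ⟨p + 1, i, le_rfl, hq, h3, by omega, by rw [lowSum_succ]; linarith⟩

/-- An exchange argument. If a witness with exactly `q` entries of `d` uses an entry of `a` that is
at least `low d q`, swapping that entry for `low d q` covers `q + 1`. Otherwise all entries of `a`
in play are smaller than `low d q`, and the cheapest choice takes no more than the required `q + 1`
entries of `d`. -/
lemma Covers.not_succ_iff (hd : Antitone d) (ha : Antitone a) {q r : ℕ} {R : ℤ} (hq : q < m)
    (h : Covers d a q r R) :
    ¬ Covers d a (q + 1) r R ↔ r ≤ q ∨ (r ≤ q + cnt a (low d q - 1) ∧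
      ¬ lowSum d (q + 1) + lowSum a (r - q - 1) ≤ R) := by
  have hcs := cnt_le a (low d q - 1)
  by_cases hr : r ≤ q
  · simp only [hr, true_or, iff_true]
    intro h'
    have := h'.le
    omega
  simp only [hr, false_or]
  constructor
  · intro h'
    refine ⟨?_, fun hB => ?_⟩
    · by_contra hA
      obtain ⟨p, i, h1, h2, h3, h4, h5⟩ := h
      by_cases hp : q + 1 ≤ p
      · exact h' ⟨p, i, hp, h2, h3, h4, h5⟩
      obtain rfl : p = q := by omega
      obtain ⟨i, rfl⟩ : ∃ i', i = i' + 1 := ⟨i - 1, by omega⟩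
      have h6 : ¬ low a i ≤ low d p - 1 := by
        rw [low_le_iff ha (by omega)]
        omega
      refine h' ⟨p + 1, i, le_rfl, hq, by omega, by omega, ?_⟩
      rw [lowSum_succ] at h5 ⊢
      omega
    · by_cases hs : r - q - 1 ≤ s
      · exact h' ⟨q + 1, r - q - 1, le_rfl, hq, hs, by omega, hB⟩
      · obtain ⟨p, i, h1, h2, h3, h4, h5⟩ := h
        exact h' ⟨p, i, by omega, h2, h3, h4, h5⟩
  · rintro ⟨hA, hB⟩ ⟨p, i, h1, h2, h3, h4, h5⟩
    apply hB
    obtain ⟨k, rfl⟩ := Nat.exists_eq_add_of_le h1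
    have e1 : r - q - 1 = i + k := by omega
    -- The `k` superfluous entries of `d` are at least `low d q`; the `k` entries of `a` replacing
    -- them are smaller.
    have g1 := lowSum_add_ge hd (p := q + 1) (k := k) (v := low d q) h2
      (fun _ => low_mono hd (by omega) (by omega))
    have g2 := lowSum_add_le ha (p := i) (k := k) (v := low d q) (by omega) (fun _ => by
      have := (low_le_iff ha (p := i + k - 1) (by omega) (low d q - 1)).2 (by omega)
      omega)
    rw [e1]
    linarith

end Covers

/-! ### Smallest entries of a union -/

section Union

variable {M N : ℕ} {x : Fin M → ℤ} {y : Fin N → ℤ}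

lemma union_antitone (x : Fin M → ℤ) (y : Fin N → ℤ) : Antitone (union x y) := fun _ _ h =>
  Tuple.monotone_sort (fun i => OrderDual.toDual (Fin.append x y i)) h

/-- The order in which the entries appear in the union. -/
lemma unionPerm_symm_lt_iff (x : Fin M → ℤ) (y : Fin N → ℤ) (u v : Fin (M + N)) :
    (unionPerm x y).symm u < (unionPerm x y).symm v ↔
      Fin.append x y v < Fin.append x y u ∨ (Fin.append x y v = Fin.append x y u ∧ u < v) := by
  have key := (Tuple.eq_sort_iff (f := fun i => OrderDual.toDual (Fin.append x y i))
    (σ := unionPerm x y)).1 rfl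
  have h1 : ∀ u v, (unionPerm x y).symm u < (unionPerm x y).symm v →
      Fin.append x y v < Fin.append x y u ∨ (Fin.append x y v = Fin.append x y u ∧ u < v) := by
    intro u v h
    have hm : Fin.append x y v ≤ Fin.append x y u := by
      have := union_antitone x y h.le
      simpa [union] using this
    rcases hm.lt_or_eq with hlt | heq
    · exact Or.inl hlt
    · refine Or.inr ⟨heq, ?_⟩
      have := key.2 _ _ h (by simp [heq])
      simpa using this
  refine ⟨h1 u v, fun h => ?_⟩
  by_contra hn
  rcases (not_lt.1 hn).lt_or_eq with hlt | heq
  · have := h1 v u hlt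
    omega
  · have := (unionPerm x y).symm.injective heq
    subst this
    omega

lemma sum_append_perm (x : Fin M → ℤ) (y : Fin N → ℤ) {X : Finset (Fin (M + N))}
    {A : Finset (Fin M)} {B : Finset (Fin N)}
    (hA : ∀ i, (unionPerm x y).symm (Fin.castAdd N i) ∈ X ↔ i ∈ A)
    (hB : ∀ i, (unionPerm x y).symm (Fin.natAdd M i) ∈ X ↔ i ∈ B) :
    ∑ i ∈ X, union x y i = ∑ i ∈ A, x i + ∑ i ∈ B, y i := by
  have h : ∑ i ∈ X, union x y i
      = ∑ i, if (unionPerm x y).symm i ∈ X then Fin.append x y i else 0 := by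
    rw [← Equiv.sum_comp (unionPerm x y)]
    simp [union]
  rw [h, Fin.sum_univ_add]
  simp [hA, hB]

lemma card_append_perm (x : Fin M → ℤ) (y : Fin N → ℤ) {X : Finset (Fin (M + N))}
    {A : Finset (Fin M)} {B : Finset (Fin N)}
    (hA : ∀ i, (unionPerm x y).symm (Fin.castAdd N i) ∈ X ↔ i ∈ A)
    (hB : ∀ i, (unionPerm x y).symm (Fin.natAdd M i) ∈ X ↔ i ∈ B) :
    X.card = A.card + B.card := by
  have h : X.card = ∑ i, if (unionPerm x y).symm i ∈ X then 1 else 0 := by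
    rw [← Equiv.sum_comp (unionPerm x y)]
    simp
  rw [h, Fin.sum_univ_add]
  simp [hA, hB]

lemma cnt_union (x : Fin M → ℤ) (y : Fin N → ℤ) (w : ℤ) :
    cnt (union x y) w = cnt x w + cnt y w := by
  apply card_append_perm x y <;>
  · intro i
    rw [Finset.mem_filter]
    simp [union]

lemma lowSum_union_cnt (hx : Antitone x) (hy : Antitone y) (w : ℤ) :
    lowSum (union x y) (cnt x w + cnt y w) = lowSum x (cnt x w) + lowSum y (cnt y w) := by
  rw [← cnt_union, lowSum_cnt (union_antitone x y), lowSum_cnt hx, lowSum_cnt hy]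
  apply sum_append_perm x y <;>
  · intro i
    rw [Finset.mem_filter]
    simp [union]

lemma lowSum_union_le (x : Fin M → ℤ) (y : Fin N → ℤ) {p q : ℕ} (hp : p ≤ M) (hq : q ≤ N) :
    lowSum (union x y) (p + q) ≤ lowSum x p + lowSum y q := by
  classical
  set X : Finset (Fin (M + N)) := Finset.univ.filter fun i =>
    Fin.addCases (motive := fun _ => Prop) (fun i => M ≤ i.val + p) (fun i => N ≤ i.val + q)
      (unionPerm x y i) with hX
  have hl : ∀ i : Fin M, (unionPerm x y).symm (Fin.castAdd N i) ∈ X ↔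
      i ∈ Finset.univ.filter fun i : Fin M => M ≤ i.val + p := by
    intro i
    simp [hX]
  have hr : ∀ i : Fin N, (unionPerm x y).symm (Fin.natAdd M i) ∈ X ↔
      i ∈ Finset.univ.filter fun i : Fin N => N ≤ i.val + q := by
    intro i
    simp [hX]
  have hc := card_append_perm x y hl hr
  have hs := sum_append_perm x y hl hr
  rw [card_upper hp, card_upper hq] at hc
  rw [← lowSum_eq x hp, ← lowSum_eq y hq] at hs
  rw [← hc, ← hs]
  exact lowSum_card_le (union_antitone x y) X

/-- Split the `r` smallest entries of the union by origin; as `r` reaches past level `w`, every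
entry of `y` up to `w` is among them. -/
lemma exists_lowSum_union_ge (hx : Antitone x) (hy : Antitone y) {r : ℕ} (hr : r ≤ M + N)
    {w : ℤ} (hw : cnt x w + cnt y w ≤ r) :
    ∃ p q : ℕ, cnt y w ≤ q ∧ q ≤ N ∧ p ≤ M ∧ q + p = r ∧
      lowSum y q + lowSum x p ≤ lowSum (union x y) r := by
  set A := Finset.univ.filter fun i : Fin M =>
    M + N ≤ ((unionPerm x y).symm (Fin.castAdd N i)).val + r with hA
  set B := Finset.univ.filter fun i : Fin N =>
    M + N ≤ ((unionPerm x y).symm (Fin.natAdd M i)).val + r with hB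
  have hc := card_append_perm x y (X := Finset.univ.filter fun i => M + N ≤ i.val + r)
    (A := A) (B := B) (by simp [hA]) (by simp [hB])
  have hs := sum_append_perm x y (X := Finset.univ.filter fun i => M + N ≤ i.val + r)
    (A := A) (B := B) (by simp [hA]) (by simp [hB])
  rw [card_upper hr] at hc
  rw [← lowSum_eq _ hr] at hs
  refine ⟨A.card, B.card, ?_, (Finset.card_le_univ _).trans (by simp), (Finset.card_le_univ _).trans
    (by simp), (add_comm _ _).trans hc.symm, ?_⟩
  · apply Finset.card_le_card
    intro i
    simp only [hB, Finset.mem_filter, Finset.mem_univ, true_and]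
    intro hi
    have := (le_iff_cnt (union_antitone x y) ((unionPerm x y).symm (Fin.natAdd M i)) w).1
      (by simpa [union] using hi)
    rw [cnt_union] at this
    omega
  · rw [hs, add_comm]
    exact add_le_add (lowSum_card_le hx _) (lowSum_card_le hy _)

lemma card_lt_eq (x : Fin N → ℤ) (w : ℤ) :
    ((Finset.univ.filter fun i => w < x i).card : ℤ) = N - cnt x w := by
  have := Finset.card_filter_add_card_filter_not (s := (Finset.univ : Finset (Fin N)))
    (fun i => x i ≤ w)
  simp only [not_le, Finset.card_univ, Fintype.card_fin] at this
  unfold cnt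
  omega

/-- The position of an entry of the second partition in the union. -/
lemma unionPerm_symm_natAdd (x : Fin M → ℤ) (hy : Antitone y) (j : Fin N) :
    (((unionPerm x y).symm (Fin.natAdd M j) : ℕ) : ℤ) = M - cnt x (y j - 1) + j := by
  have hc := card_append_perm x y (X := Finset.Iio ((unionPerm x y).symm (Fin.natAdd M j)))
    (A := Finset.univ.filter fun i => y j - 1 < x i) (B := Finset.Iio j)
    (fun i => by
      rw [Finset.mem_Iio, unionPerm_symm_lt_iff]
      simp only [Finset.mem_filter, Finset.mem_univ, true_and, Fin.append_left, Fin.append_right,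
        Fin.lt_def, Fin.val_castAdd, Fin.val_natAdd]
      omega)
    (fun i => by
      rw [Finset.mem_Iio, unionPerm_symm_lt_iff]
      simp only [Finset.mem_Iio, Fin.append_right, Fin.lt_def, Fin.val_natAdd]
      have h1 : j.val ≤ i.val → y i ≤ y j := fun h => hy h
      have h2 : i.val ≤ j.val → y j ≤ y i := fun h => hy h
      omega)
  rw [Fin.card_Iio, Fin.card_Iio] at hc
  rw [hc, ← card_lt_eq]
  push_cast
  ring

end Union

lemma psum_tail {N : ℕ} (x : Fin N → ℤ) {p : ℕ} (hp : p ≤ N) {r : ℤ} (hr : r + p = N + 1) :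
    psum x r N = lowSum x p := by
  rw [lowSum_eq x hp, psum]
  congr 1
  ext i
  simp only [Finset.mem_filter, Finset.mem_univ, true_and]
  have := i.2
  omega

lemma psum_segment {N : ℕ} (x : Fin N → ℤ) {p q : ℕ} (hq : q ≤ p) (hp : p ≤ N) {r t : ℤ}
    (hr : r + p = N + 1) (ht : t + q = N) : psum x r t = lowSum x p - lowSum x q := by
  rw [lowSum_eq x hp, lowSum_eq x (hq.trans hp), psum, eq_sub_iff_add_eq,
    ← Finset.sum_union]
  · congr 1
    ext i
    simp only [Finset.mem_filter, Finset.mem_univ, true_and, Finset.mem_union]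
    have := i.2
    omega
  · rw [Finset.disjoint_filter]
    intro i _
    have := i.2
    omega

lemma psum_head {N : ℕ} (x : Fin N → ℤ) {p : ℕ} (hp : p ≤ N) {t : ℤ} (ht : t + p = N) :
    psum x 1 t = ∑ i, x i - lowSum x p := by
  rw [psum_segment x hp le_rfl (by omega) ht, lowSum_top]

lemma extSum_tail_le_iff {N : ℕ} (x : Fin N → ℤ) {p : ℕ} (hp : p ≤ N) {r : ℤ}
    (hr : r + p = N + 1) (u v : ℤ) :
    (u : WithTop ℤ) + extSum x r N ≤ (v : WithTop ℤ) ↔ u + lowSum x p ≤ v := by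
  rw [extSum, if_neg (by omega), psum_tail x hp hr]
  norm_cast

/-! ### The clauses of (i) as covering conditions -/

section CondAt

variable {m s n : ℕ} {d : Fin m → ℤ} {a : Fin s → ℤ} {c : Fin n → ℤ}
  {Δ : Finset (Fin m)} {S : Finset (Fin n)}

/-- Condition (i) at one element of `S`. -/
def CondAt (d : Fin m → ℤ) (a : Fin s → ℤ) (c : Fin n → ℤ)
    (Δ : Finset (Fin m)) (S : Finset (Fin n)) (l : Fin n) : Prop :=
  tIdx (s := s) d c Δ S l ≤ mIdx a c l →
    extSum (union a d) (zIdx d c l + tIdx (s := s) d c Δ S l) (zIdx d c l + mIdx a c l) ≤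
      (((∑ i ∈ S with l ≤ i, c i)
        - (∑ i ∈ Finset.univ.filter (fun i : Fin m => zIdx d c l + 1 ≤ ((i : ℕ) : ℤ) + 1 ∧ i ∉ Δ), d i)
        - psum a (mIdx a c l + 1) s : ℤ) : WithTop ℤ)

lemma mIdx_eq (a : Fin s → ℤ) (c : Fin n → ℤ) (l : Fin n) : mIdx a c l = s - cnt a (c l) :=
  card_lt_eq a (c l)

lemma zIdx_eq (d : Fin m → ℤ) (c : Fin n → ℤ) (l : Fin n) : zIdx d c l = m - cnt d (c l) :=
  card_lt_eq d (c l)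

lemma lt_iff_zIdx (hd : Antitone d) (hcd : ∀ (i : Fin n) (j : Fin m), c i ≠ d j) (l : Fin n)
    (i : Fin m) : zIdx d c l + 1 ≤ ((i : ℕ) : ℤ) + 1 ↔ d i < c l := by
  rw [zIdx_eq, lt_iff_le_and_ne, le_iff_cnt hd, and_iff_left (hcd l i).symm]
  omega

/-- A clause sees only the entries of `d` below `c l` and the elements of `S` from `l` on, so it is
unaffected by entries treated later. -/
lemma condAt_insert_left (hd : Antitone d) (hcd : ∀ (i : Fin n) (j : Fin m), c i ≠ d j)
    {l : Fin n} {j : Fin m} (hj : c l < d j) :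
    CondAt d a c (insert j Δ) S l ↔ CondAt d a c Δ S l := by
  have h1 : ∀ i, (i ∉ insert j Δ ∧ d i < c l) ↔ (i ∉ Δ ∧ d i < c l) := by
    intro i
    rw [Finset.mem_insert]
    have : i = j → ¬ d i < c l := by rintro rfl; omega
    tauto
  have h2 : ∀ i : Fin m, (zIdx d c l + 1 ≤ ((i : ℕ) : ℤ) + 1 ∧ i ∉ insert j Δ) ↔
      (zIdx d c l + 1 ≤ ((i : ℕ) : ℤ) + 1 ∧ i ∉ Δ) := by
    intro i
    rw [lt_iff_zIdx hd hcd]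
    have := h1 i
    tauto
  simp only [CondAt, tIdx, h1, h2]

lemma condAt_insert_right {l l' : Fin n} (hl : l' < l) :
    CondAt d a c Δ (insert l' S) l ↔ CondAt d a c Δ S l := by
  have h1 : (insert l' S).filter (fun i => l < i) = S.filter (fun i => l < i) := by
    rw [Finset.filter_insert, if_neg (by omega)]
  have h2 : (insert l' S).filter (fun i => l ≤ i) = S.filter (fun i => l ≤ i) := by
    rw [Finset.filter_insert, if_neg (by omega)]
  simp only [CondAt, tIdx, h1, h2]

lemma cond_insert_left (hd : Antitone d) (hcd : ∀ (i : Fin n) (j : Fin m), c i ≠ d j)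
    {j : Fin m} (hj : ∀ l ∈ S, c l < d j) :
    Cond d a c (insert j Δ) S ↔ Cond d a c Δ S :=
  forall₂_congr fun l hl => condAt_insert_left hd hcd (hj l hl)

lemma cond_insert_right {l' : Fin n} (hl : ∀ l ∈ S, l' < l) :
    Cond d a c Δ (insert l' S) ↔ CondAt d a c Δ (insert l' S) l' ∧ Cond d a c Δ S := by
  change (∀ l ∈ insert l' S, CondAt d a c Δ (insert l' S) l) ↔ _ ∧ (∀ l ∈ S, CondAt d a c Δ S l)
  rw [Finset.forall_mem_insert]
  exact and_congr_right fun _ => forall₂_congr fun l hl' => condAt_insert_right (hl l hl')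

/-- Once `r` reaches past level `w`, the `r` smallest entries of the union contain all entries of
`d` up to `w`, so the constraint in `Covers` costs nothing. -/
lemma covers_iff_union (hd : Antitone d) (ha : Antitone a) {r : ℕ} {R w : ℤ}
    (hr : cnt a w + cnt d w ≤ r) :
    Covers d a (cnt d w) r R ↔ r ≤ m + s ∧ lowSum (union a d) r ≤ R := by
  constructor
  · intro h
    refine ⟨h.le_length, ?_⟩
    obtain ⟨p, i, h1, h2, h3, rfl, h5⟩ := h
    have := lowSum_union_le a d h3 h2
    rw [add_comm p i]
    linarith
  · rintro ⟨h1, h2⟩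
    obtain ⟨i, p, g1, g2, g3, g4, g5⟩ := exists_lowSum_union_ge ha hd (by omega) hr
    exact ⟨p, i, g1, g2, g3, g4, g5.trans h2⟩

lemma sum_not_mem (hd : Antitone d) {w : ℤ} (hΔ : ∀ i ∈ Δ, d i ≤ w) :
    ∑ i with d i ≤ w ∧ i ∉ Δ, d i = lowSum d (cnt d w) - ∑ i ∈ Δ, d i := by
  rw [lowSum_cnt hd, eq_sub_iff_add_eq, ← Finset.sum_union]
  · congr 1
    ext i
    simp only [Finset.mem_union, Finset.mem_filter, Finset.mem_univ, true_and]
    have := hΔ i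
    tauto
  · rw [Finset.disjoint_left]
    simp

lemma card_not_mem {w : ℤ} (hΔ : ∀ i ∈ Δ, d i ≤ w) :
    ((Finset.univ.filter fun i => i ∉ Δ ∧ d i ≤ w).card : ℤ) = cnt d w - Δ.card := by
  have : cnt d w = (Finset.univ.filter fun i => i ∉ Δ ∧ d i ≤ w).card + Δ.card := by
    rw [cnt, ← Finset.card_union_of_disjoint]
    · congr 1
      ext i
      simp only [Finset.mem_union, Finset.mem_filter, Finset.mem_univ, true_and]
      have := hΔ i
      tauto
    · rw [Finset.disjoint_left]
      simp +contextual
  omega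

/-- With `r = Δ.card + S.card`, the premise `t ≤ m` of the clause says `cnt a (c l) + cnt d (c l) ≤
r`. The segment of `e` then runs from the `(r + 1)`-th smallest entry down to the last one exceeding
`c l`, and the remaining terms account for everything up to `c l`. -/
lemma condAt_iff_covers (hd : Antitone d) (ha : Antitone a)
    (hcd : ∀ (i : Fin n) (j : Fin m), c i ≠ d j) {l : Fin n}
    (hΔ : ∀ i ∈ Δ, d i < c l) (hS : ∀ i ∈ S, l < i)
    (h : Covers d a (cnt d (c l)) (Δ.card + S.card) (∑ i ∈ Δ, d i + ∑ i ∈ S, c i)) :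
    CondAt d a c Δ (insert l S) l ↔ Covers d a (cnt d (c l)) (Δ.card + S.card + 1)
      (∑ i ∈ Δ, d i + ∑ i ∈ S, c i + c l) := by
  have hlS : l ∉ S := fun hl => lt_irrefl _ (hS l hl)
  have hlt : ∀ i, d i < c l ↔ d i ≤ c l := fun i =>
    ⟨le_of_lt, fun h => lt_of_le_of_ne h (hcd l i).symm⟩
  have hΔ' : ∀ i ∈ Δ, d i ≤ c l := fun i hi => (hΔ i hi).le
  have e1 : (insert l S).filter (fun i => l < i) = S := by
    rw [Finset.filter_insert, if_neg (lt_irrefl l), Finset.filter_true_of_mem hS]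
  have e2 : (insert l S).filter (fun i => l ≤ i) = insert l S :=
    Finset.filter_true_of_mem (by
      intro i hi
      rcases Finset.mem_insert.1 hi with rfl | hi
      exacts [le_rfl, (hS i hi).le])
  have ht : tIdx (s := s) d c Δ (insert l S) l
      = (s : ℤ) + cnt d (c l) - (Δ.card + S.card : ℕ) := by
    simp only [tIdx, e1, hlt]
    rw [card_not_mem hΔ']
    push_cast
    ring
  simp only [CondAt, ht, e2, lt_iff_zIdx hd hcd, hlt, sum_not_mem hd hΔ',
    Finset.sum_insert hlS]
  simp only [mIdx_eq, zIdx_eq]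
  have hca := cnt_le a (c l)
  have hcm := cnt_le d (c l)
  rw [psum_tail a hca (by omega)]
  by_cases hr : cnt a (c l) + cnt d (c l) ≤ Δ.card + S.card
  · rw [covers_iff_union hd ha (by omega)]
    have hp : (s : ℤ) + cnt d (c l) - (Δ.card + S.card : ℕ) ≤ s - cnt a (c l) := by omega
    simp only [hp, true_imp_iff]
    have hu := lowSum_union_cnt ha hd (c l)
    by_cases hN : Δ.card + S.card + 1 ≤ m + s
    · rw [extSum, if_neg (by omega),
        psum_segment (union a d) (p := Δ.card + S.card + 1) (q := cnt a (c l) + cnt d (c l))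
          (by omega) (by omega) (by push_cast; omega) (by push_cast; omega), hu]
      simp only [hN, true_and, WithTop.coe_le_coe]
      constructor <;> intro _ <;> linarith
    -- Here `r + 1` exceeds the length of the union: the segment starts at an index `≤ 0`, its sum
    -- is `+∞`, and both sides fail.
    · rw [extSum, if_pos (by omega)]
      simp [hN]
  · have hp : ¬ (s : ℤ) + cnt d (c l) - (Δ.card + S.card : ℕ) ≤ s - cnt a (c l) := by omega
    simp only [hp, false_imp_iff, true_iff]
    -- The clause is vacuous and covering is automatic: the witness leaves unused an entry of `a`
    -- that is at most `c l`.
    obtain ⟨p, i, h1, h2, h3, h4, h5⟩ := h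
    refine ⟨p, i + 1, h1, h2, by omega, by omega, ?_⟩
    have := (low_le_iff ha (p := i) (by omega) (c l)).2 (by omega)
    rw [lowSum_succ]
    linarith

end CondAt

/-! ### The selection rule in terms of counts and sums -/

section Rule

variable {m s n : ℕ} {d : Fin m → ℤ} {a : Fin s → ℤ} {c : Fin n → ℤ}
  {Δ : Finset (Fin m)} {S : Finset (Fin n)}

lemma card_not_mem_add (w : ℤ) :
    (Finset.univ.filter fun i => i ∉ Δ ∧ d i ≤ w).card + (Δ.filter fun i => d i ≤ w).card
      = cnt d w := by
  rw [cnt, ← Finset.card_union_of_disjoint]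
  · congr 1
    ext i
    simp only [Finset.mem_union, Finset.mem_filter, Finset.mem_univ, true_and]
    tauto
  · rw [Finset.disjoint_left]
    simp +contextual

/-- Condition (a) ignores the elements of `Δ` above `c l`, with `l` the least element of `S`. The
hypothesis `H` compensates: if there is such an element, the right-hand side is false as well. -/
lemma condA_iff (hd : Antitone d) (hc : Antitone c)
    (hcd : ∀ (i : Fin n) (j : Fin m), c i ≠ d j) {j : Fin m} {p : ℕ} (hj : (j : ℕ) + p + 1 = m)
    (hΔ : ∀ i ∈ Δ, m ≤ (i : ℕ) + p) (hS : ∀ i ∈ S, c i < d j)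
    (H : ∀ i ∈ Δ, (∀ l ∈ S, c l < d i) → Δ.card + S.card ≤ p + cnt a (d i - 1)) :
    CondA d a c Δ S j ↔ p + cnt a (d j - 1) < Δ.card + S.card := by
  have key : ∀ l ∈ S, (∀ i ∈ S, l ≤ i) →
      ((tIdx (s := s) d c Δ S l ≤ mIdx a c l ∧
        AmongSmallest d a j (c l) (mIdx a c l - tIdx (s := s) d c Δ S l + 1)) ↔
      p + cnt a (d j - 1) < (Δ.filter fun i => d i ≤ c l).card + S.card) := by
    intro l hl hmin
    have hlt : ∀ i, d i < c l ↔ d i ≤ c l := fun i =>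
      ⟨le_of_lt, fun h => lt_of_le_of_ne h (hcd l i).symm⟩
    have e1 : S.filter (fun i => l < i) = S.erase l := by
      ext i
      simp only [Finset.mem_filter, Finset.mem_erase]
      refine ⟨fun h => ⟨h.2.ne', h.1⟩, fun h => ⟨h.2, lt_of_le_of_ne (hmin i h.2) h.1.symm⟩⟩
    have e2 := card_not_mem_add (Δ := Δ) (d := d) (c l)
    have e3 : 0 < S.card := Finset.card_pos.2 ⟨l, hl⟩
    have e4 := hS l hl
    have e5 : cnt d (c l) ≤ p := by
      have := (le_iff_cnt hd j (c l)).not.1 (by omega)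
      omega
    have e6 := cnt_mono a (show c l ≤ d j - 1 by omega)
    have e7 := card_lt_eq (union a d) (c l)
    rw [cnt_union] at e7
    simp only [AmongSmallest, tIdx, mIdx_eq, hlt, e1, Finset.card_erase_of_mem hl,
      unionPerm_symm_natAdd a hd, e7]
    push_cast [e3]
    omega
  constructor
  · rintro ⟨l, hl, hlj, hmin, h1, h2⟩
    have h3 := (key l hl fun i hi => hmin i hi (hS i hi)).1 ⟨h1, h2⟩
    have h4 : (Δ.filter fun i => d i ≤ c l).card ≤ Δ.card := Finset.card_filter_le _ _
    omega
  · intro h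
    have hΔp : Δ.card ≤ p := by
      have := Finset.card_le_card (fun i hi => by simpa using hΔ i hi :
        Δ ⊆ Finset.univ.filter fun i : Fin m => m ≤ i.val + p)
      rwa [card_upper (by omega)] at this
    have hne : S.Nonempty := by
      rw [← Finset.card_pos]
      omega
    have hl := S.min'_mem hne
    have hmin : ∀ i ∈ S, S.min' hne ≤ i := fun i hi => S.min'_le i hi
    set l := S.min' hne
    have hf : Δ.filter (fun i => d i ≤ c l) = Δ := by
      apply Finset.filter_true_of_mem
      intro i hi
      by_contra hlt
      have h1 := H i hi fun l' hl' => (hc (hmin l' hl')).trans_lt (not_le.1 hlt)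
      have h2 := hΔ i hi
      have h3 : d i ≤ d j := hd (Fin.le_def.2 (by omega))
      have h4 := cnt_mono a (show d i - 1 ≤ d j - 1 by omega)
      omega
    obtain ⟨h1, h2⟩ := (key l hl hmin).2 (by rw [hf]; exact h)
    exact ⟨l, hl, hS l hl, fun i hi _ => hmin i hi, h1, h2⟩

/-- The rule in terms of the numbers and the sums of the entries chosen so far. -/
lemma chosen_iff (hd : Antitone d) (hc : Antitone c)
    (hcd : ∀ (i : Fin n) (j : Fin m), c i ≠ d j) {j : Fin m} {p : ℕ} (hj : (j : ℕ) + p + 1 = m)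
    (hΔ : ∀ i ∈ Δ, m ≤ (i : ℕ) + p) (hS : ∀ i ∈ S, c i < d j)
    (H : ∀ i ∈ Δ, (∀ l ∈ S, c l < d i) → Δ.card + S.card ≤ p + cnt a (d i - 1)) :
    Chosen d a c Δ S j ↔ Δ.card + S.card ≤ p ∨ (Δ.card + S.card ≤ p + cnt a (d j - 1) ∧
      ¬ lowSum d (p + 1) + lowSum a (Δ.card + S.card - p - 1) ≤ ∑ i ∈ Δ, d i + ∑ i ∈ S, c i) := by
  have hSf : S.filter (fun i => c i < d j) = S := Finset.filter_true_of_mem hS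
  have hjΔ : ∀ i ∈ Δ, j < i := fun i hi => Fin.lt_def.2 (by have := hΔ i hi; omega)
  have hdisj : Disjoint (Finset.univ.filter fun i => i ∉ Δ ∧ j < i) Δ := by
    rw [Finset.disjoint_left]
    simp +contextual
  have hun : (Finset.univ.filter fun i => i ∉ Δ ∧ j < i) ∪ Δ =
      Finset.univ.filter fun i : Fin m => m ≤ (i : ℕ) + p := by
    ext i
    simp only [Finset.mem_union, Finset.mem_filter, Finset.mem_univ, true_and]
    have h1 := hjΔ i
    have h2 : j < i ↔ m ≤ (i : ℕ) + p := by rw [Fin.lt_def]; omega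
    tauto
  have hcard := Finset.card_union_of_disjoint hdisj
  rw [hun, card_upper (by omega)] at hcard
  have hsum := Finset.sum_union hdisj (f := d)
  rw [hun, ← lowSum_eq d (by omega)] at hsum
  -- Hence `q_j > s` means that fewer than `p + 1` entries have been chosen.
  have hq : qIdx (s := s) d c Δ S j = (s : ℤ) + p + 1 - (Δ.card + S.card : ℕ) := by
    have : (Finset.univ.filter fun i => j < i ∧ i ∉ Δ)
        = (Finset.univ.filter fun i => i ∉ Δ ∧ j < i) := by
      ext i
      simp [and_comm]
    rw [qIdx, hSf, this]
    omega
  have hdj := low_apply d j hj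
  rw [Chosen, hq]
  by_cases hp : Δ.card + S.card ≤ p
  · simp only [hp, true_or, iff_true]
    left
    omega
  have h1 : ¬ (s : ℤ) < (s : ℤ) + p + 1 - (Δ.card + S.card : ℕ) := by omega
  simp only [hp, h1, false_or]
  rw [condA_iff hd hc hcd hj hΔ hS H, not_lt]
  refine and_congr_right fun hA => not_congr ?_
  -- By `hA` the tail of `a` in (b) has at most `s` entries, so it does not run into the convention
  -- `+∞`.
  have hcs := cnt_le a (d j - 1)
  rw [CondB, hSf, extSum_tail_le_iff a (p := Δ.card + S.card - p - 1) (by omega)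
    (by rw [hq]; omega), lowSum_succ, hdj]
  constructor <;> intro _ <;> linarith

end Rule

/-! ### The construction as a run, and its invariants -/

/-- The states of the construction of `(Δ, S)`: the pairs of sets which are reached when the `p`
smallest entries of `d` and the `q` smallest entries of `c` have been treated. -/
inductive Run {m s n k : ℕ} (d : Fin m → ℤ) (a : Fin s → ℤ) (c : Fin n → ℤ) (b : Fin k → ℤ) :
    ℕ → ℕ → Finset (Fin m) → Finset (Fin n) → Prop
  | nil : Run d a c b 0 0 ∅ ∅
  | left {p q : ℕ} {Δ Δ' : Finset (Fin m)} {S : Finset (Fin n)} (j : Fin m) :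
      Run d a c b p q Δ S → (j : ℕ) + p + 1 = m → (∀ i : Fin n, c i < d j ↔ n ≤ (i : ℕ) + q) →
      ((Chosen d a c Δ S j ∧ Δ' = insert j Δ) ∨ (¬ Chosen d a c Δ S j ∧ Δ' = Δ)) →
      Run d a c b (p + 1) q Δ' S
  | right {p q : ℕ} {Δ : Finset (Fin m)} {S S' : Finset (Fin n)} (j : Fin n) :
      Run d a c b p q Δ S → (j : ℕ) + q + 1 = n → (∀ i : Fin m, d i < c j ↔ m ≤ (i : ℕ) + p) →
      ((Chosen c b d S Δ j ∧ S' = insert j S) ∨ (¬ Chosen c b d S Δ j ∧ S' = S)) →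
      Run d a c b p (q + 1) Δ S'

section Run

variable {m s n k : ℕ} {d : Fin m → ℤ} {a : Fin s → ℤ} {c : Fin n → ℤ} {b : Fin k → ℤ}
  {Δ Δ' : Finset (Fin m)} {S : Finset (Fin n)} {p q : ℕ}

/-- The entries which have been chosen so far are among those which have been treated, and a
chosen entry of `d` which exceeds all the chosen entries of `c` bounds the number of the
chosen entries. -/
def History (d : Fin m → ℤ) (a : Fin s → ℤ) (c : Fin n → ℤ) (p : ℕ)
    (Δ : Finset (Fin m)) (S : Finset (Fin n)) : Prop :=
  (∀ i ∈ Δ, m ≤ (i : ℕ) + p) ∧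
    ∀ i ∈ Δ, (∀ l ∈ S, c l < d i) → Δ.card + S.card ≤ p + cnt a (d i - 1)

lemma History.step (hd : Antitone d) (hc : Antitone c)
    (hcd : ∀ (i : Fin n) (j : Fin m), c i ≠ d j) (h₁ : History d a c p Δ S)
    (h₂ : History c b d q S Δ) {j : Fin m} (hj : (j : ℕ) + p + 1 = m)
    (hq : ∀ i : Fin n, c i < d j ↔ n ≤ (i : ℕ) + q)
    (hΔ' : (Chosen d a c Δ S j ∧ Δ' = insert j Δ) ∨ (¬ Chosen d a c Δ S j ∧ Δ' = Δ)) :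
    History d a c (p + 1) Δ' S ∧ History c b d q S Δ' := by
  have hS : ∀ i ∈ S, c i < d j := fun i hi => (hq i).2 (h₂.1 i hi)
  have hjΔ : j ∉ Δ := fun h => by have := h₁.1 j h; omega
  rcases hΔ' with ⟨hch, rfl⟩ | ⟨-, rfl⟩
  · rw [chosen_iff hd hc hcd hj h₁.1 hS h₁.2] at hch
    refine ⟨⟨?_, ?_⟩, h₂.1, ?_⟩
    · intro i hi
      rcases Finset.mem_insert.1 hi with rfl | hi
      · omega
      · have := h₁.1 i hi
        omega
    · intro i hi hl
      rw [Finset.card_insert_of_notMem hjΔ]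
      rcases Finset.mem_insert.1 hi with rfl | hi
      · omega
      · have := h₁.2 i hi hl
        omega
    -- The new entry exceeds every chosen entry of `c`, so the dual bound holds vacuously.
    · intro i hi hl
      have := hl j (Finset.mem_insert_self _ _)
      have := hS i hi
      omega
  · refine ⟨⟨fun i hi => ?_, fun i hi hl => ?_⟩, h₂⟩
    · have := h₁.1 i hi
      omega
    · have := h₁.2 i hi hl
      omega

lemma Run.history (hd : Antitone d) (hc : Antitone c)
    (hcd : ∀ (i : Fin n) (j : Fin m), c i ≠ d j) (h : Run d a c b p q Δ S) :
    History d a c p Δ S ∧ History c b d q S Δ := by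
  induction h with
  | nil => simp [History]
  | left j _ hj hq hΔ' ih => exact ih.1.step hd hc hcd ih.2 hj hq hΔ'
  | right j _ hj hq hS' ih =>
    exact (ih.2.step hc hd (fun i j => (hcd j i).symm) ih.1 hj hq hS').symm

open Classical in
/-- The construction of `(Δ, S)` as a run. -/
lemma run_sets (hd : Antitone d) (hc : Antitone c)
    (hcd : ∀ (i : Fin n) (j : Fin m), c i ≠ d j) :
    Run d a c b m n (setΔ d a c b) (setS d a c b) := by
  set L := List.ofFn fun i => unionPerm d c i with hL
  have hlen : L.length = m + n := by simp [hL]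
  -- After `t` steps the treated entries are the last `t` of the union of `d` and `c`.
  have key : ∀ t ≤ m + n, Run d a c b
      (Finset.univ.filter fun i : Fin m =>
        m + n - t ≤ ((unionPerm d c).symm (Fin.castAdd n i) : ℕ)).card
      (Finset.univ.filter fun i : Fin n =>
        m + n - t ≤ ((unionPerm d c).symm (Fin.natAdd m i) : ℕ)).card
      ((L.drop (m + n - t)).foldr (stepSets d a c b) (∅, ∅)).1
      ((L.drop (m + n - t)).foldr (stepSets d a c b) (∅, ∅)).2 := by
    intro t ht
    induction t with
    | zero =>
      have h1 : ∀ i : Fin (m + n), ¬ m + n - 0 ≤ (i : ℕ) := fun i => by have := i.2; omega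
      have h2 : L.drop (m + n - 0) = [] := by
        rw [List.drop_eq_nil_iff]
        omega
      simp only [h1, h2, Finset.filter_false, Finset.card_empty, List.foldr_nil]
      exact Run.nil
    | succ t ih =>
      have ih := ih (by omega)
      obtain ⟨e, he⟩ : ∃ e, e = m + n - (t + 1) := ⟨_, rfl⟩
      have he1 : m + n - t = e + 1 := by omega
      rw [he1] at ih
      rw [← he]
      have hen : e < m + n := by omega
      rw [List.drop_eq_getElem_cons (by omega), List.foldr_cons]
      have hLe : L[e] = unionPerm d c ⟨e, hen⟩ := by simp [hL]
      rw [hLe]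
      set P := (L.drop (e + 1)).foldr (stepSets d a c b) (∅, ∅)
      obtain ⟨x, hx⟩ : ∃ x, x = unionPerm d c ⟨e, hen⟩ := ⟨_, rfl⟩
      have hxe : ((unionPerm d c).symm x : ℕ) = e := by rw [hx]; simp
      have hpos : ∀ y : Fin (m + n), e + 1 ≤ ((unionPerm d c).symm y : ℕ) ↔
          (unionPerm d c).symm x < (unionPerm d c).symm y := by
        intro y
        rw [Fin.lt_def, hxe]
        omega
      have hpos' : ∀ y : Fin (m + n), e ≤ ((unionPerm d c).symm y : ℕ) ↔
          (y = x ∨ e + 1 ≤ ((unionPerm d c).symm y : ℕ)) := by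
        intro y
        have : y = x ↔ ((unionPerm d c).symm y : ℕ) = e := by
          rw [← hxe, ← Fin.ext_iff, (unionPerm d c).symm.injective.eq_iff]
        rw [this]
        omega
      rw [← hx]
      simp only [hpos']
      simp only [hpos, unionPerm_symm_lt_iff] at ih ⊢
      clear_value P
      clear hpos hpos' hxe hx hLe
      induction x using Fin.addCases with
      | left j =>
        have e1 : ∀ i : Fin m, ((Fin.append d c (Fin.castAdd n i) <
            Fin.append d c (Fin.castAdd n j) ∨ (Fin.append d c (Fin.castAdd n i) =
            Fin.append d c (Fin.castAdd n j) ∧ Fin.castAdd n j < Fin.castAdd n i)) ↔ j < i) := by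
          intro i
          simp only [Fin.append_left, Fin.lt_def, Fin.val_castAdd]
          have h1 : j.val ≤ i.val → d i ≤ d j := fun h => hd h
          have h2 : i.val ≤ j.val → d j ≤ d i := fun h => hd h
          omega
        have e2 : ∀ i : Fin n, ((Fin.append d c (Fin.natAdd m i) <
            Fin.append d c (Fin.castAdd n j) ∨ (Fin.append d c (Fin.natAdd m i) =
            Fin.append d c (Fin.castAdd n j) ∧ Fin.castAdd n j < Fin.natAdd m i)) ↔
            c i ≤ d j - 1) := by
          intro i
          simp only [Fin.append_left, Fin.append_right]
          have := hcd i j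
          omega
        have e3 : ∀ i : Fin n, Fin.natAdd m i ≠ Fin.castAdd n j := by
          intro i h
          have := congrArg Fin.val h
          simp only [Fin.val_natAdd, Fin.val_castAdd] at this
          have := j.2
          omega
        have e4 : ∀ i : Fin m, Fin.castAdd n i = Fin.castAdd n j ↔ i = j := by
          intro i
          simp [Fin.ext_iff]
        simp only [e1, e2] at ih
        simp only [e1, e2, e3, e4, false_or]
        have e5 : (Finset.univ.filter fun i => i = j ∨ j < i).card
            = (Finset.univ.filter fun i => j < i).card + 1 := by
          rw [← Finset.card_insert_of_notMem (a := j) (by simp)]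
          congr 1
          ext i
          simp
        have e6 : (Finset.univ.filter fun i => j < i) = Finset.Ioi j := by ext i; simp
        rw [e5]
        have e7 : (stepSets d a c b (Fin.castAdd n j) P).2 = P.2 := by
          simp only [stepSets, Fin.addCases_left]
          split_ifs <;> rfl
        rw [e7]
        refine Run.left j ih ?_ ?_ ?_
        · rw [e6, Fin.card_Ioi]
          have := j.2
          omega
        · intro i
          rw [← Int.le_sub_one_iff, le_iff_cnt hc]
          rfl
        · simp only [stepSets, Fin.addCases_left]
          by_cases h : Chosen d a c P.1 P.2 j <;> simp [h]
      | right j =>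
        have e1 : ∀ i : Fin n, ((Fin.append d c (Fin.natAdd m i) <
            Fin.append d c (Fin.natAdd m j) ∨ (Fin.append d c (Fin.natAdd m i) =
            Fin.append d c (Fin.natAdd m j) ∧ Fin.natAdd m j < Fin.natAdd m i)) ↔ j < i) := by
          intro i
          simp only [Fin.append_right, Fin.lt_def, Fin.val_natAdd]
          have h1 : j.val ≤ i.val → c i ≤ c j := fun h => hc h
          have h2 : i.val ≤ j.val → c j ≤ c i := fun h => hc h
          omega
        have e2 : ∀ i : Fin m, ((Fin.append d c (Fin.castAdd n i) <
            Fin.append d c (Fin.natAdd m j) ∨ (Fin.append d c (Fin.castAdd n i) =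
            Fin.append d c (Fin.natAdd m j) ∧ Fin.natAdd m j < Fin.castAdd n i)) ↔
            d i ≤ c j - 1) := by
          intro i
          simp only [Fin.append_left, Fin.append_right]
          have := hcd j i
          omega
        have e3 : ∀ i : Fin m, Fin.castAdd n i ≠ Fin.natAdd m j := by
          intro i h
          have := congrArg Fin.val h
          simp only [Fin.val_natAdd, Fin.val_castAdd] at this
          have := i.2
          omega
        have e4 : ∀ i : Fin n, Fin.natAdd m i = Fin.natAdd m j ↔ i = j := by
          intro i
          simp [Fin.ext_iff]
        simp only [e1, e2] at ih
        simp only [e1, e2, e3, e4, false_or]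
        have e5 : (Finset.univ.filter fun i => i = j ∨ j < i).card
            = (Finset.univ.filter fun i => j < i).card + 1 := by
          rw [← Finset.card_insert_of_notMem (a := j) (by simp)]
          congr 1
          ext i
          simp
        have e6 : (Finset.univ.filter fun i => j < i) = Finset.Ioi j := by ext i; simp
        rw [e5]
        have e7 : (stepSets d a c b (Fin.natAdd m j) P).1 = P.1 := by
          simp only [stepSets, Fin.addCases_right]
          split_ifs <;> rfl
        rw [e7]
        refine Run.right j ih ?_ ?_ ?_
        · rw [e6, Fin.card_Ioi]
          have := j.2
          omega
        · intro i
          rw [← Int.le_sub_one_iff, le_iff_cnt hd]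
          rfl
        · simp only [stepSets, Fin.addCases_right]
          by_cases h : Chosen c b d P.2 P.1 j <;> simp [h]
  have h := key (m + n) le_rfl
  simp only [Nat.sub_self, Nat.zero_le, Finset.filter_true, List.drop_zero, Finset.card_univ,
    Fintype.card_fin] at h
  exact h

end Run

/-! ### Generalized majorization as covering at every level -/

section Ext

variable {N : ℕ} (x : Fin N → ℤ)

lemma ext_of_le {i : ℤ} (hi : i ≤ 0) : ext x i = ⊤ := if_pos hi

lemma ext_of_lt {i : ℤ} (hi : (N : ℤ) < i) : ext x i = ⊥ := by
  rw [ext, if_neg (by omega), dif_neg (by omega)]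

lemma ext_eq_low {i : ℤ} {p : ℕ} (hi : 1 ≤ i) (hp : i + p = N) :
    ext x i = ((low x p : ℤ) : WithTop ℤ) := by
  have h : (i - 1).toNat < N := by omega
  rw [ext, if_neg (by omega), dif_pos h, low_apply x ⟨(i - 1).toNat, h⟩ (by simp only; omega)]

lemma coe_lt_coe_ext {u v : ℤ} :
    (((u : ℤ) : WithTop ℤ) : WithBot (WithTop ℤ)) < ((v : ℤ) : WithTop ℤ) ↔ u < v := by
  norm_cast

lemma coe_le_coe_ext {u v : ℤ} :
    (((u : ℤ) : WithTop ℤ) : WithBot (WithTop ℤ)) ≤ ((v : ℤ) : WithTop ℤ) ↔ u ≤ v := by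
  norm_cast

lemma low_le_low_of_ext_le {M : ℕ} {y : Fin M → ℤ} {x : Fin N → ℤ} {i u : ℤ} {r : ℕ}
    (h : ext x i ≤ ext y u) (hi : 1 ≤ i) (hr : i + r = N) (hu : 1 ≤ u) :
    ∃ p : ℕ, u + p = M ∧ low x r ≤ low y p := by
  rw [ext_eq_low x hi hr] at h
  by_cases hM : u ≤ M
  · obtain ⟨p, hp⟩ : ∃ p : ℕ, u + p = M := ⟨(M - u).toNat, by omega⟩
    rw [ext_eq_low y hu hp, coe_le_coe_ext] at h
    exact ⟨p, hp, h⟩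
  · rw [ext_of_lt y (by omega)] at h
    exact absurd h (by simp)

end Ext

section Majorization

variable {N m s : ℕ} {g : Fin N → ℤ} {d : Fin m → ℤ} {a : Fin s → ℤ}

/-- The value `⊥` beyond the end of `d` puts `m + j` into the defining set; the value `⊤` at indices
`≤ 0` keeps out everything below `j`. -/
lemma hIdx_mem (hN : N = m + s) {j : ℕ} (hj : 1 ≤ j) (hjs : j ≤ s) :
    ext d ((hIdx g d j : ℤ) - j + 1) < ext g (hIdx g d j) ∧ j ≤ hIdx g d j ∧
      hIdx g d j ≤ m + j := by
  have hmem : m + j ∈ {i : ℕ | ext d ((i : ℤ) - j + 1) < ext g i} := by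
    rw [Set.mem_ofPred_eq, ext_of_lt d (by push_cast; omega),
      ext_eq_low g (p := s - j) (by push_cast; omega) (by push_cast; omega)]
    exact WithBot.bot_lt_coe _
  have h := Nat.sInf_mem ⟨_, hmem⟩
  refine ⟨h, ?_, Nat.sInf_le hmem⟩
  by_contra hlt
  rw [Set.mem_ofPred_eq] at h
  change ext d ((hIdx g d j : ℤ) - j + 1) < _ at h
  rw [ext_of_le d (by omega)] at h
  exact not_top_lt h

lemma ext_le_of_lt_hIdx {i j : ℕ} (h : i < hIdx g d j) :
    ext g i ≤ ext d ((i : ℤ) - j + 1) :=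
  not_lt.1 (Nat.notMem_of_lt_sInf h)

/-- A generalized majorization, cut at the level `w`. -/
lemma GenMajorized.covers (h : GenMajorized g d a) (hg : Antitone g) (hd : Antitone d) (w : ℤ) :
    Covers d a (cnt d w) (cnt g w) (lowSum g (cnt g w)) := by
  obtain ⟨hN, hle, hps, htot⟩ := h
  obtain ⟨t, ht⟩ : ∃ t, t + cnt g w = N := ⟨N - cnt g w, by have := cnt_le g w; omega⟩
  -- With `t` the number of entries of `g` above `w`, this selects the last `j` with `h_j ≤ t`, or
  -- `0` if there is none.
  have hstep : ∀ J ≤ s, ∃ j ≤ J, (j = 0 ∨ hIdx g d j ≤ t) ∧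
      (j = J ∨ ¬ hIdx g d (j + 1) ≤ t) := by
    intro J
    induction J with
    | zero => exact fun _ => ⟨0, le_rfl, Or.inl rfl, Or.inl rfl⟩
    | succ J ih =>
      intro hJ
      obtain ⟨j, h1, h2, h3⟩ := ih (by omega)
      by_cases hh : hIdx g d (J + 1) ≤ t
      · exact ⟨J + 1, le_rfl, Or.inr hh, Or.inl rfl⟩
      · refine ⟨j, by omega, h2, Or.inr ?_⟩
        rcases h3 with rfl | h3
        exacts [hh, h3]
  obtain ⟨j, hjs, hj, hj'⟩ := hstep s le_rfl
  obtain ⟨h, hjh, hht, hhm, hsum⟩ : ∃ h, j ≤ h ∧ h ≤ t ∧ h ≤ m + j ∧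
      lowSum d (m + j - h) + lowSum a (s - j) ≤ lowSum g (N - h) := by
    by_cases hj0 : j = 0
    · subst hj0
      refine ⟨0, le_rfl, Nat.zero_le _, Nat.zero_le _, ?_⟩
      simp only [Nat.add_zero, Nat.sub_zero, lowSum_top]
      exact htot.ge
    · obtain ⟨-, h2, h3⟩ := hIdx_mem (g := g) (d := d) (j := j) hN (by omega) hjs
      refine ⟨hIdx g d j, h2, hj.resolve_left hj0, h3, ?_⟩
      have := hps j (by omega) hjs
      rw [psum_head g (p := N - hIdx g d j) (by omega) (by omega),
        psum_head d (p := m + j - hIdx g d j) (by omega) (by omega),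
        psum_head a (p := s - j) (by omega) (by omega)] at this
      linarith
  -- For `j < s` this holds because `i` lies below `h_{j+1}`; for `j = s` it is condition (1).
  have hext : ∀ i : ℕ, 1 ≤ i → i ≤ t → ext g i ≤ ext d ((i : ℤ) - j) := by
    intro i hi hit
    rcases hj' with rfl | hj'
    · by_cases hij : i ≤ j
      · rw [ext_of_le d (by omega)]
        exact le_top
      · have := hle (i - j) (by omega) (by omega)
        push_cast [show j ≤ i by omega] at this
        simpa using this
    · have := ext_le_of_lt_hIdx (show i < hIdx g d (j + 1) by omega)
      push_cast at this
      rwa [show (i : ℤ) - (j + 1) + 1 = i - j by ring] at this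
  -- Walk from `h` to `t`, discarding at each step an entry of `g` and a matching entry of `d` that
  -- is no smaller.
  have hind : ∀ k, h + k ≤ t → h + k ≤ m + j ∧
      lowSum d (m + j - (h + k)) + lowSum a (s - j) ≤ lowSum g (N - (h + k)) := by
    intro k
    induction k with
    | zero => exact fun _ => ⟨hhm, hsum⟩
    | succ k ih =>
      intro hk
      obtain ⟨h1, h2⟩ := ih (by omega)
      obtain ⟨p, hp, hlow⟩ := low_le_low_of_ext_le (hext (h + k + 1) (by omega) (by omega))
        (r := N - (h + k + 1)) (by omega) (by omega) (by omega)
      refine ⟨by omega, ?_⟩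
      rw [show m + j - (h + k) = p + 1 by omega,
        show N - (h + k) = (N - (h + k + 1)) + 1 by omega, lowSum_succ, lowSum_succ] at h2
      rw [show m + j - (h + (k + 1)) = p by omega,
        show N - (h + (k + 1)) = N - (h + k + 1) by omega]
      linarith
  obtain ⟨k, rfl⟩ := Nat.exists_eq_add_of_le hht
  obtain ⟨h1, h2⟩ := hind k le_rfl
  refine ⟨m + j - (h + k), s - j, ?_, by omega, by omega, by omega, ?_⟩
  · by_cases ht0 : h + k ≤ j
    · have := cnt_le d w
      omega
    · obtain ⟨p, hp, hlow⟩ := low_le_low_of_ext_le (hext (h + k) (by omega) le_rfl)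
        (r := cnt g w) (by omega) (by omega) (by omega)
      by_contra hlt
      have h3 := (low_le_iff hd (p := p) (by omega) w).2 (by omega)
      have h4 := (low_le_iff hg (p := cnt g w) (by omega) w).1 (hlow.trans h3)
      omega
  · rwa [show N - (h + k) = cnt g w by omega] at h2

/-- This is inequality (2) seen from below, with `p₀ = m + j - h_j` and `i₀ = s - j`; `hlast` and
`hnext` express that `h_j` lies in its defining set and is minimal. The level at which to apply
covering depends on how the largest entry of `a` in the sum compares with `v = g_{h_j}`. -/
lemma lowSum_le_of_covers (hg : Antitone g) (hd : Antitone d) (ha : Antitone a)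
    (hN : N = m + s)
    (h : ∀ w, Covers d a (cnt d w) (cnt g w) (lowSum g (cnt g w))) {p₀ i₀ : ℕ} (hp₀ : p₀ ≤ m)
    (hi₀ : i₀ < s) (hlast : p₀ = 0 ∨ low d (p₀ - 1) < low g (p₀ + i₀))
    (hnext : ∀ k, p₀ + k < m → low g (p₀ + i₀ + k + 1) ≤ low d (p₀ + k)) :
    lowSum d p₀ + lowSum a i₀ ≤ lowSum g (p₀ + i₀) := by
  set v := low g (p₀ + i₀) with hv
  by_cases hcase : i₀ = 0 ∨ low a (i₀ - 1) ≤ v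
  -- Just below `v`: the surplus entries of `g` and `d` are at least `v`, the missing entries of `a`
  -- at most `v`.
  · obtain ⟨p, i, h1, h2, h3, h4, h5⟩ := h (v - 1)
    have hr : cnt g (v - 1) ≤ p₀ + i₀ := by
      by_contra hlt
      have := (low_le_iff hg (p := p₀ + i₀) (by omega) (v - 1)).2 (by omega)
      omega
    have hp : p₀ ≤ p := by
      rcases hlast with h0 | hlt
      · omega
      · by_cases h0 : p₀ = 0
        · omega
        have := (low_le_iff hd (p := p₀ - 1) (by omega) (v - 1)).1 (by omega)
        omega
    obtain ⟨y, hy⟩ := Nat.exists_eq_add_of_le hr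
    obtain ⟨z, rfl⟩ := Nat.exists_eq_add_of_le hp
    obtain rfl : i₀ = i + (y + z) := by omega
    have g1 := lowSum_add_ge hg (p := cnt g (v - 1)) (k := y) (v := v) (by omega) (fun _ => by
      have := (low_le_iff hg (p := cnt g (v - 1)) (by omega) (v - 1)).not.2 (by omega)
      omega)
    have g2 := lowSum_add_ge hd (p := p₀) (k := z) (v := v) h2 (fun _ => by
      have e1 := hnext 0 (by omega)
      have e2 := low_mono hg (show p₀ + (i + (y + z)) ≤ p₀ + (i + (y + z)) + 0 + 1 by omega)
        (by omega)
      rw [Nat.add_zero p₀] at e1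
      linarith)
    have g3 := lowSum_add_le ha (p := i) (k := y + z) (v := v) (by omega) (fun _ => by
      rcases hcase with h0 | h0
      · omega
      · exact h0)
    rw [hy]
    push_cast at g3
    linarith
  · push Not at hcase
    obtain ⟨hi0, hlt⟩ := hcase
    set W := low a (i₀ - 1) with hW
    obtain ⟨p, i, h1, h2, h3, h4, h5⟩ := h W
    have hr : p₀ + i₀ < cnt g W := (low_le_iff hg (by omega) W).1 (by omega)
    have hrd : p₀ ≤ cnt d W := by
      rcases hlast with h0 | hlt'
      · omega
      · by_cases h0 : p₀ = 0
        · omega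
        have := (low_le_iff hd (p := p₀ - 1) (by omega) W).1 (by omega)
        omega
    have hcd := cnt_le d W
    have hcg := cnt_le g W
    obtain ⟨x, hx⟩ := Nat.exists_eq_add_of_le hr.le
    obtain ⟨y, rfl⟩ := Nat.exists_eq_add_of_le (hrd.trans h1)
    have hxd : cnt d W ≤ p₀ + x := by
      by_contra hlt'
      have e1 := (low_le_iff hd (p := p₀ + x) (by omega) W).2 (by omega)
      have e2 := (low_le_iff hg (p := p₀ + i₀ + x + 1) (by omega) W).1
        ((hnext x (by omega)).trans e1)
      omega
    -- At level `W`, surplus entries of `g` are paired with larger or equal entries of `d`; whatever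
    -- is left over is compared with `W`.
    have hpair : ∀ k, p₀ + k ≤ m →
        lowSum d p₀ + lowSum g (p₀ + i₀ + k) ≤ lowSum d (p₀ + k) + lowSum g (p₀ + i₀) := by
      intro k
      induction k with
      | zero => simp
      | succ k ih =>
        intro hk
        have e1 := ih (by omega)
        have e2 := hnext k (by omega)
        have e3 := low_mono hg (show p₀ + i₀ + k ≤ p₀ + i₀ + k + 1 by omega) (by omega)
        rw [← add_assoc, ← add_assoc, lowSum_succ, lowSum_succ]
        linarith
    rw [hx] at h5
    by_cases hyx : y ≤ x
    · obtain ⟨z, rfl⟩ := Nat.exists_eq_add_of_le hyx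
      obtain rfl : i = i₀ + z := by omega
      have g1 := hpair y h2
      have g2 := lowSum_add_le hg (p := p₀ + i₀ + y) (k := z) (v := W) (by omega) (fun _ =>
        (low_le_iff hg (by omega) W).2 (by omega))
      have g3 := lowSum_add_ge ha (p := i₀) (k := z) (v := W) h3 (fun _ =>
        low_mono ha (by omega) (by omega))
      rw [← add_assoc] at h5
      linarith
    · obtain ⟨z, rfl⟩ := Nat.exists_eq_add_of_le (not_le.1 hyx).le
      obtain rfl : i₀ = i + z := by omega
      have g1 := hpair x (by omega)
      have g2 := lowSum_add_ge hd (p := p₀ + x) (k := z) (v := W) (by omega) (fun _ => by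
        have := (low_le_iff hd (p := p₀ + x) (by omega) W).not.2 (by omega)
        omega)
      have g3 := lowSum_add_le ha (p := i) (k := z) (v := W) (by omega) (fun _ => le_rfl)
      rw [← add_assoc] at h5
      linarith

lemma genMajorized_of_covers (hg : Antitone g) (hd : Antitone d) (ha : Antitone a)
    (hN : N = m + s) (htot : ∑ i, g i = ∑ i, d i + ∑ i, a i)
    (h : ∀ w, Covers d a (cnt d w) (cnt g w) (lowSum g (cnt g w))) : GenMajorized g d a := by
  refine ⟨hN, ?_, ?_, htot⟩
  · intro i hi him
    have h1 : m - i < cnt d (low d (m - i)) := (low_le_iff hd (by omega) _).1 le_rfl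
    have h2 := (h (low d (m - i))).le
    rw [ext_eq_low g (p := m - i) (by omega) (by omega),
      ext_eq_low d (p := m - i) (by omega) (by omega), coe_le_coe_ext]
    exact (low_le_iff hg (by omega) _).2 (by omega)
  · intro j hj hjs
    obtain ⟨h1, h2, h3⟩ := hIdx_mem (g := g) (d := d) hN hj hjs
    have hlt : ∀ i < hIdx g d j, ext g i ≤ ext d ((i : ℤ) - j + 1) :=
      fun i hi => ext_le_of_lt_hIdx hi
    generalize hIdx g d j = t at h1 h2 h3 hlt
    obtain ⟨p₀, hp₀⟩ : ∃ p₀, p₀ + t = m + j := ⟨m + j - t, by omega⟩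
    have key := lowSum_le_of_covers hg hd ha hN h (p₀ := p₀) (i₀ := s - j) (by omega) (by omega)
      ?_ ?_
    · rw [psum_head g (p := p₀ + (s - j)) (by omega) (by omega),
        psum_head d (p := p₀) (by omega) (by omega),
        psum_head a (p := s - j) (by omega) (by omega)]
      linarith
    · by_cases h0 : p₀ = 0
      · exact Or.inl h0
      · right
        rwa [ext_eq_low d (p := p₀ - 1) (by omega) (by omega),
          ext_eq_low g (p := p₀ + (s - j)) (by omega) (by omega), coe_lt_coe_ext] at h1
    · intro k hk
      obtain ⟨p, hp, hlow⟩ := low_le_low_of_ext_le (hlt (t - (k + 1)) (by omega))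
        (r := p₀ + (s - j) + k + 1) (by omega) (by omega) (by omega)
      rwa [show p₀ + k = p by omega]

end Majorization

/-! ### One step of the construction -/

section Step

variable {m s n k : ℕ} {d : Fin m → ℤ} {a : Fin s → ℤ} {c : Fin n → ℤ} {b : Fin k → ℤ}
  {Δ Δ' : Finset (Fin m)} {S : Finset (Fin n)} {p q : ℕ}

lemma Run.le_length (h : Run d a c b p q Δ S) : p ≤ m ∧ q ≤ n := by
  induction h with
  | nil => simp
  | left j _ hj hq hΔ' ih => omega
  | right j _ hj hq hS' ih => omega

lemma cnt_eq_of_lt_iff {v : ℤ} (hv : ∀ i, c i ≠ v) (hqn : q ≤ n)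
    (hq : ∀ i : Fin n, c i < v ↔ n ≤ (i : ℕ) + q) : cnt c v = q := by
  rw [cnt, ← card_upper hqn]
  congr 1
  ext i
  simp only [Finset.mem_filter, Finset.mem_univ, true_and]
  rw [← hq, lt_iff_le_and_ne, and_iff_left (hv i)]

lemma Covers.chosen_iff (hd : Antitone d) (ha : Antitone a) (hc : Antitone c)
    (hcd : ∀ (i : Fin n) (j : Fin m), c i ≠ d j) (h₁ : History d a c p Δ S)
    (h₂ : History c b d q S Δ) {j : Fin m} (hj : (j : ℕ) + p + 1 = m)
    (hq : ∀ i : Fin n, c i < d j ↔ n ≤ (i : ℕ) + q)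
    (h : Covers d a p (Δ.card + S.card) (∑ i ∈ Δ, d i + ∑ i ∈ S, c i)) :
    Chosen d a c Δ S j ↔
      ¬ Covers d a (p + 1) (Δ.card + S.card) (∑ i ∈ Δ, d i + ∑ i ∈ S, c i) := by
  rw [h.not_succ_iff hd ha (by omega), low_apply d j hj]
  exact PartitionPairs.chosen_iff hd hc hcd hj h₁.1 (fun i hi => (hq i).2 (h₂.1 i hi)) h₁.2

lemma cond_insert_iff (hc : Antitone c) (hb : Antitone b)
    (hcd : ∀ (i : Fin n) (j : Fin m), c i ≠ d j) (h₁ : History d a c p Δ S)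
    (h₂ : History c b d q S Δ) {j : Fin m} (hj : (j : ℕ) + p + 1 = m) (hqn : q ≤ n)
    (hq : ∀ i : Fin n, c i < d j ↔ n ≤ (i : ℕ) + q)
    (h : Covers c b q (Δ.card + S.card) (∑ i ∈ Δ, d i + ∑ i ∈ S, c i)) :
    Cond c b d S (insert j Δ) ↔
      Covers c b q (Δ.card + S.card + 1) (∑ i ∈ Δ, d i + ∑ i ∈ S, c i + d j) ∧
        Cond c b d S Δ := by
  have hjΔ : ∀ i ∈ Δ, j < i := fun i hi => Fin.lt_def.2 (by have := h₁.1 i hi; omega)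
  have hcnt := cnt_eq_of_lt_iff (fun i => hcd i j) hqn hq
  rw [cond_insert_right hjΔ, condAt_iff_covers hc hb (fun i j => (hcd j i).symm)
    (fun i hi => (hq i).2 (h₂.1 i hi)) hjΔ
    (by rw [hcnt, add_comm S.card, add_comm (∑ i ∈ S, c i)]; exact h),
    hcnt, add_comm S.card, add_comm (∑ i ∈ S, c i)]

end Step

/-! ### Sufficiency: the chosen entries satisfy both demands -/

section Sufficiency

variable {m s n k : ℕ} {d : Fin m → ℤ} {a : Fin s → ℤ} {c : Fin n → ℤ} {b : Fin k → ℤ}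
  {Δ Δ' : Finset (Fin m)} {S : Finset (Fin n)} {p q : ℕ}

/-- The chosen entries, and those of them which are at most `w` for any `w` whose level has been
passed, satisfy the conditions given by `d` and `a`. -/
def Feasible (d : Fin m → ℤ) (a : Fin s → ℤ) (c : Fin n → ℤ) (p q : ℕ)
    (Δ : Finset (Fin m)) (S : Finset (Fin n)) : Prop :=
  Covers d a p (Δ.card + S.card) (∑ i ∈ Δ, d i + ∑ i ∈ S, c i) ∧
    ∀ w, cnt d w ≤ p → cnt c w ≤ q →
      Covers d a (cnt d w) ((Δ.filter fun i => d i ≤ w).card + (S.filter fun i => c i ≤ w).card)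
        (∑ i ∈ Δ with d i ≤ w, d i + ∑ i ∈ S with c i ≤ w, c i)

/-- Either `w` lies below the new entry, and nothing changes at that level, or `w` lies above
everything treated, and filtering has no effect. -/
lemma filter_step (hd : Antitone d) {j : Fin m} (hj : (j : ℕ) + p + 1 = m) (hqn : q ≤ n)
    (hq : ∀ i : Fin n, c i < d j ↔ n ≤ (i : ℕ) + q) (hΔ : ∀ i ∈ Δ, m ≤ (i : ℕ) + p)
    (hS : ∀ i ∈ S, n ≤ (i : ℕ) + q) (hΔ' : Δ' = insert j Δ ∨ Δ' = Δ) {w : ℤ}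
    (hdw : cnt d w ≤ p + 1) (hcw : cnt c w ≤ q) :
    (cnt d w ≤ p ∧ Δ'.filter (fun i => d i ≤ w) = Δ.filter (fun i => d i ≤ w)) ∨
      (cnt d w = p + 1 ∧ cnt c w = q ∧ Δ'.filter (fun i => d i ≤ w) = Δ' ∧
        S.filter (fun i => c i ≤ w) = S) := by
  have hjw := le_iff_cnt hd j w
  by_cases h : cnt d w ≤ p
  · refine Or.inl ⟨h, ?_⟩
    rcases hΔ' with rfl | rfl
    · rw [Finset.filter_insert, if_neg (by rw [hjw]; omega)]
    · rfl
  · have hle : d j ≤ w := by rw [hjw]; omega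
    refine Or.inr ⟨by omega, le_antisymm hcw ?_, ?_, ?_⟩
    · rw [← card_upper hqn]
      apply Finset.card_le_card
      intro i
      simp only [Finset.mem_filter, Finset.mem_univ, true_and]
      intro hi
      exact ((hq i).2 hi).le.trans hle
    · apply Finset.filter_true_of_mem
      intro i hi
      refine (hd (Fin.le_def.2 ?_)).trans hle
      rcases hΔ' with rfl | rfl
      · rcases Finset.mem_insert.1 hi with rfl | hi
        · exact le_rfl
        · have := hΔ i hi
          omega
      · have := hΔ i hi
        omega
    · exact Finset.filter_true_of_mem fun i hi => ((hq i).2 (hS i hi)).le.trans hle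

lemma Feasible.step (hd : Antitone d) (ha : Antitone a) (hc : Antitone c) (hb : Antitone b)
    (hcd : ∀ (i : Fin n) (j : Fin m), c i ≠ d j) (h₁ : History d a c p Δ S)
    (h₂ : History c b d q S Δ) {j : Fin m} (hj : (j : ℕ) + p + 1 = m) (hqn : q ≤ n)
    (hq : ∀ i : Fin n, c i < d j ↔ n ≤ (i : ℕ) + q)
    (hΔ' : (Chosen d a c Δ S j ∧ Δ' = insert j Δ) ∨ (¬ Chosen d a c Δ S j ∧ Δ' = Δ))
    (hcond : Cond c b d S Δ') (hf₁ : Feasible d a c p q Δ S) (hf₂ : Feasible c b d q p S Δ) :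
    Feasible d a c (p + 1) q Δ' S ∧ Feasible c b d q (p + 1) S Δ' := by
  have hf := fun w => filter_step (w := w) hd hj hqn hq h₁.1 h₂.1 (hΔ'.imp And.right And.right)
  have hjΔ : j ∉ Δ := fun h => by have := h₁.1 j h; omega
  have hf₂' := hf₂.1
  rw [add_comm S.card, add_comm (∑ i ∈ S, c i)] at hf₂'
  have key : Covers d a (p + 1) (Δ'.card + S.card) (∑ i ∈ Δ', d i + ∑ i ∈ S, c i) ∧
      Covers c b q (S.card + Δ'.card) (∑ i ∈ S, c i + ∑ i ∈ Δ', d i) := by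
    rw [hf₁.1.chosen_iff hd ha hc hcd h₁ h₂ hj hq] at hΔ'
    rcases hΔ' with ⟨hch, rfl⟩ | ⟨hch, rfl⟩
    · have e1 := hf₁.1.insert_entry (by omega) hch
      have e2 := ((cond_insert_iff hc hb hcd h₁ h₂ hj hqn hq hf₂').1 hcond).1
      rw [low_apply d j hj] at e1
      rw [Finset.card_insert_of_notMem hjΔ, Finset.sum_insert hjΔ]
      constructor
      · convert e1 using 1 <;> ring
      · convert e2 using 1 <;> ring
    · exact ⟨not_not.1 hch, hf₂.1⟩
  refine ⟨⟨key.1, fun w hdw hcw => ?_⟩, ⟨key.2, fun w hcw hdw => ?_⟩⟩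
  · rcases hf w hdw hcw with ⟨e1, e2⟩ | ⟨e1, e2, e3, e4⟩
    · rw [e2]
      exact hf₁.2 w e1 hcw
    · rw [e1, e3, e4]
      exact key.1
  · rcases hf w hdw hcw with ⟨e1, e2⟩ | ⟨e1, e2, e3, e4⟩
    · rw [e2]
      exact hf₂.2 w hcw e1
    · rw [e2, e3, e4]
      exact key.2

/-- Conditions on the final sets descend to every earlier state, which lets the induction along a
run use them. -/
lemma Cond.of_step (hd : Antitone d) (hcd : ∀ (i : Fin n) (j : Fin m), c i ≠ d j)
    (h₁ : History d a c p Δ S) (h₂ : History c b d q S Δ) {j : Fin m}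
    (hj : (j : ℕ) + p + 1 = m) (hq : ∀ i : Fin n, c i < d j ↔ n ≤ (i : ℕ) + q)
    (hΔ' : Δ' = insert j Δ ∨ Δ' = Δ) (hc₁ : Cond d a c Δ' S) (hc₂ : Cond c b d S Δ') :
    Cond d a c Δ S ∧ Cond c b d S Δ := by
  rcases hΔ' with rfl | rfl
  · exact ⟨(cond_insert_left hd hcd fun i hi => (hq i).2 (h₂.1 i hi)).1 hc₁,
      ((cond_insert_right fun i hi => Fin.lt_def.2 (by have := h₁.1 i hi; omega)).1 hc₂).2⟩
  · exact ⟨hc₁, hc₂⟩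

lemma Run.feasible (hd : Antitone d) (ha : Antitone a) (hc : Antitone c) (hb : Antitone b)
    (hcd : ∀ (i : Fin n) (j : Fin m), c i ≠ d j) (h : Run d a c b p q Δ S)
    (hc₁ : Cond d a c Δ S) (hc₂ : Cond c b d S Δ) :
    Feasible d a c p q Δ S ∧ Feasible c b d q p S Δ := by
  induction h with
  | nil =>
    refine ⟨⟨covers_zero, fun w hw _ => ?_⟩, covers_zero, fun w hw _ => ?_⟩ <;>
    · rw [Nat.le_zero.1 hw]
      exact covers_zero
  | left j hr hj hq hΔ' ih =>
    obtain ⟨h₁, h₂⟩ := hr.history hd hc hcd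
    obtain ⟨g₁, g₂⟩ := hc₁.of_step hd hcd h₁ h₂ hj hq (hΔ'.imp And.right And.right) hc₂
    obtain ⟨f₁, f₂⟩ := ih g₁ g₂
    exact f₁.step hd ha hc hb hcd h₁ h₂ hj hr.le_length.2 hq hΔ' hc₂ f₂
  | right j hr hj hq hS' ih =>
    obtain ⟨h₁, h₂⟩ := hr.history hd hc hcd
    have hdc : ∀ (i : Fin m) (j : Fin n), d i ≠ c j := fun i j => (hcd j i).symm
    obtain ⟨g₂, g₁⟩ := hc₂.of_step hc hdc h₂ h₁ hj hq (hS'.imp And.right And.right) hc₁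
    obtain ⟨f₁, f₂⟩ := ih g₁ g₂
    exact (f₂.step hc hb hd ha hdc h₂ h₁ hj hr.le_length.1 hq hS' hc₁ f₁).symm

end Sufficiency

/-! ### Necessity: every common `g` dominates the chosen entries -/

section Necessity

variable {m s n k N : ℕ} {d : Fin m → ℤ} {a : Fin s → ℤ} {c : Fin n → ℤ} {b : Fin k → ℤ}
  {g : Fin N → ℤ} {Δ Δ' : Finset (Fin m)} {S : Finset (Fin n)} {p q : ℕ}

/-- Above the treated entries, `g` has at least as many entries below a level as have been
chosen, and they are at least as far from the level. -/
def Dominated (g : Fin N → ℤ) (d : Fin m → ℤ) (c : Fin n → ℤ) (p q : ℕ)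
    (Δ : Finset (Fin m)) (S : Finset (Fin n)) : Prop :=
  ∀ w, p ≤ cnt d w → q ≤ cnt c w → Δ.card + S.card ≤ cnt g w ∧
    w * ((Δ.card + S.card : ℕ) : ℤ) - (∑ i ∈ Δ, d i + ∑ i ∈ S, c i) ≤
      w * cnt g w - lowSum g (cnt g w)

lemma Dominated.symm (h : Dominated g d c p q Δ S) : Dominated g c d q p S Δ := by
  intro w hq hp
  rw [add_comm S.card, add_comm (∑ i ∈ S, c i)]
  exact h w hp hq

/-- The entries between `v` and `w` contribute nonnegative terms `w - e`. -/
lemma tail_convex (hg : Antitone g) {v w : ℤ} (h : v ≤ w) :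
    w * cnt g v - lowSum g (cnt g v) ≤ w * cnt g w - lowSum g (cnt g w) := by
  obtain ⟨t, ht⟩ := Nat.exists_eq_add_of_le (cnt_mono g h)
  have hN := cnt_le g w
  have := lowSum_add_le hg (p := cnt g v) (k := t) (v := w) (by omega) (fun _ =>
    (low_le_iff hg (by omega) w).2 (by omega))
  rw [ht]
  push_cast
  linarith

lemma Dominated.step (hd : Antitone d) (ha : Antitone a) (hc : Antitone c) (hb : Antitone b)
    (hg : Antitone g)
    (hcd : ∀ (i : Fin n) (j : Fin m), c i ≠ d j)
    (hgd : ∀ w, Covers d a (cnt d w) (cnt g w) (lowSum g (cnt g w)))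
    (hgc : ∀ w, Covers c b (cnt c w) (cnt g w) (lowSum g (cnt g w)))
    (h₁ : History d a c p Δ S) (h₂ : History c b d q S Δ) {j : Fin m}
    (hj : (j : ℕ) + p + 1 = m) (hqn : q ≤ n)
    (hq : ∀ i : Fin n, c i < d j ↔ n ≤ (i : ℕ) + q)
    (hΔ' : (Chosen d a c Δ S j ∧ Δ' = insert j Δ) ∨ (¬ Chosen d a c Δ S j ∧ Δ' = Δ))
    (hV₁ : Covers d a p (Δ.card + S.card) (∑ i ∈ Δ, d i + ∑ i ∈ S, c i))
    (hV₂ : Covers c b q (S.card + Δ.card) (∑ i ∈ S, c i + ∑ i ∈ Δ, d i))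
    (hc₁ : Cond d a c Δ S) (hc₂ : Cond c b d S Δ)
    (hdom : Dominated g d c p q Δ S) :
    (Covers d a (p + 1) (Δ'.card + S.card) (∑ i ∈ Δ', d i + ∑ i ∈ S, c i) ∧
      Covers c b q (S.card + Δ'.card) (∑ i ∈ S, c i + ∑ i ∈ Δ', d i)) ∧
    (Cond d a c Δ' S ∧ Cond c b d S Δ') ∧ Dominated g d c (p + 1) q Δ' S := by
  have hjΔ : j ∉ Δ := fun h => by have := h₁.1 j h; omega
  rw [hV₁.chosen_iff hd ha hc hcd h₁ h₂ hj hq] at hΔ'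
  rcases hΔ' with ⟨hch, rfl⟩ | ⟨hch, rfl⟩
  · have hcnt := cnt_eq_of_lt_iff (fun i => hcd i j) hqn hq
    have hp : p + 1 ≤ cnt d (d j) := by
      have := (le_iff_cnt hd j (d j)).1 le_rfl
      omega
    rw [add_comm S.card, add_comm (∑ i ∈ S, c i)] at hV₂
    obtain ⟨D1, D2⟩ := hdom (d j) (by omega) hcnt.ge
    -- With equal counts, domination at level `d j` would make the chosen sum at least that of `g`,
    -- and the covering satisfied by `g` would pass to the chosen entries, making `d j` unnecessary.
    have hlt : Δ.card + S.card + 1 ≤ cnt g (d j) := by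
      by_contra hn
      have heq : cnt g (d j) = Δ.card + S.card := by omega
      have := hgd (d j)
      rw [heq] at this D2
      exact hch (this.mono hp (by linarith))
    have hV₂' : Covers c b q (Δ.card + S.card + 1)
        (∑ i ∈ Δ, d i + ∑ i ∈ S, c i + d j) := by
      have h3 := hgc (d j)
      rw [hcnt] at h3
      -- Interpolate between the chosen entries and the entries of `g` up to `d j`, with slope `d
      -- j`; domination gives the upper estimate.
      refine hV₂.interpolate hc hb (x := d j) h3 (by omega) hlt ?_ ?_
      · push_cast
        linarith
      · have : (0 : ℤ) ≤ cnt g (d j) - ((Δ.card + S.card + 1 : ℕ) : ℤ) := by omega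
        push_cast at this D2 ⊢
        linarith
    have e1 := hV₁.insert_entry (by omega) hch
    rw [low_apply d j hj] at e1
    refine ⟨?_, ⟨?_, ?_⟩, ?_⟩
    · rw [Finset.card_insert_of_notMem hjΔ, Finset.sum_insert hjΔ]
      constructor
      · convert e1 using 1 <;> ring
      · convert hV₂' using 1 <;> ring
    · exact (cond_insert_left hd hcd fun i hi => (hq i).2 (h₂.1 i hi)).2 hc₁
    · exact (cond_insert_iff hc hb hcd h₁ h₂ hj hqn hq hV₂).2 ⟨hV₂', hc₂⟩
    · intro w hpw hqw
      have hle : d j ≤ w := by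
        rw [le_iff_cnt hd]
        omega
      rw [Finset.card_insert_of_notMem hjΔ, Finset.sum_insert hjΔ]
      have f1 := cnt_mono g hle
      refine ⟨by omega, ?_⟩
      have f2 := tail_convex hg hle
      have f3 : (0 : ℤ) ≤ (w - d j) * (cnt g (d j) - ((Δ.card + S.card + 1 : ℕ) : ℤ)) :=
        mul_nonneg (by omega) (by omega)
      push_cast at f3 D2 ⊢
      linarith
  · exact ⟨⟨not_not.1 hch, hV₂⟩, ⟨hc₁, hc₂⟩, fun w hp hq => hdom w (by omega) hq⟩

lemma Run.dominated (hd : Antitone d) (ha : Antitone a) (hc : Antitone c) (hb : Antitone b)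
    (hg : Antitone g) (hcd : ∀ (i : Fin n) (j : Fin m), c i ≠ d j)
    (hgd : ∀ w, Covers d a (cnt d w) (cnt g w) (lowSum g (cnt g w)))
    (hgc : ∀ w, Covers c b (cnt c w) (cnt g w) (lowSum g (cnt g w)))
    (h : Run d a c b p q Δ S) :
    (Covers d a p (Δ.card + S.card) (∑ i ∈ Δ, d i + ∑ i ∈ S, c i) ∧
      Covers c b q (S.card + Δ.card) (∑ i ∈ S, c i + ∑ i ∈ Δ, d i)) ∧
    (Cond d a c Δ S ∧ Cond c b d S Δ) ∧ Dominated g d c p q Δ S := by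
  induction h with
  | nil =>
    refine ⟨⟨covers_zero, covers_zero⟩, ⟨fun l hl => ?_, fun l hl => ?_⟩, fun w _ _ => ?_⟩
    · simp at hl
    · simp at hl
    · have hN := cnt_le g w
      have := lowSum_add_le hg (p := 0) (k := cnt g w) (v := w) (by omega) (fun _ =>
        (low_le_iff hg (by omega) w).2 (by omega))
      rw [lowSum_zero, zero_add] at this
      simp
      linarith
  | left j hr hj hq hΔ' ih =>
    obtain ⟨h₁, h₂⟩ := hr.history hd hc hcd
    obtain ⟨⟨v₁, v₂⟩, ⟨g₁, g₂⟩, hdom⟩ := ih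
    exact hdom.step hd ha hc hb hg hcd hgd hgc h₁ h₂ hj hr.le_length.2 hq hΔ' v₁ v₂ g₁ g₂
  | right j hr hj hq hS' ih =>
    obtain ⟨h₁, h₂⟩ := hr.history hd hc hcd
    obtain ⟨⟨v₁, v₂⟩, ⟨g₁, g₂⟩, hdom⟩ := ih
    obtain ⟨t₁, t₂, t₃⟩ := hdom.symm.step hc hb hd ha hg (fun i j => (hcd j i).symm) hgc hgd
      h₂ h₁ hj hr.le_length.1 hq hS' v₂ v₁ g₂ g₁
    exact ⟨t₁.symm, t₂.symm, t₃.symm⟩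

end Necessity

/-! ### Flattening the chosen multiset to the required length and sum -/

section Construction

lemma exists_antitone_map_eq (M : Multiset ℤ) {N : ℕ} (hM : M.card = N) :
    ∃ g : Fin N → ℤ, Antitone g ∧ (Finset.univ : Finset (Fin N)).val.map g = M := by
  have hlen : (M.sort (· ≥ ·)).length = N := (M.length_sort _).trans hM
  have hs := Multiset.pairwise_sort M (· ≥ ·)
  refine ⟨fun i => (M.sort (· ≥ ·)).get (i.cast hlen.symm), fun i j hij => ?_, ?_⟩
  · exact hs.rel_get_of_le (by simpa using hij)
  · rw [Fin.univ_val_map]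
    conv_rhs => rw [← M.sort_eq (· ≥ ·)]
    congr 1
    apply List.ext_getElem <;> simp [hM]

lemma cnt_eq_card_filter {N : ℕ} (g : Fin N → ℤ) (w : ℤ) :
    cnt g w = ((Finset.univ.val.map g).filter (· ≤ w)).card := by
  rw [Multiset.filter_map, Multiset.card_map]
  rfl

lemma lowSum_cnt_eq_sum_filter {N : ℕ} {g : Fin N → ℤ} (hg : Antitone g) (w : ℤ) :
    lowSum g (cnt g w) = ((Finset.univ.val.map g).filter (· ≤ w)).sum := by
  rw [lowSum_cnt hg, Multiset.filter_map]
  rfl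

/-- Entries equal to `x + 1` contribute zero at level `x + 1`. -/
lemma tail_succ (M : Multiset ℤ) (x : ℤ) :
    (x + 1) * ((M.filter (· ≤ x + 1)).card : ℤ) - (M.filter (· ≤ x + 1)).sum =
      (x + 1) * ((M.filter (· ≤ x)).card : ℤ) - (M.filter (· ≤ x)).sum := by
  induction M using Multiset.induction with
  | empty => simp
  | cons e M ih =>
    by_cases h1 : e ≤ x
    · rw [Multiset.filter_cons_of_pos (p := fun e => e ≤ x) M h1,
        Multiset.filter_cons_of_pos (p := fun e => e ≤ x + 1) M (show e ≤ x + 1 by omega)]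
      simp only [Multiset.card_cons, Multiset.sum_cons]
      push_cast
      linarith
    · rw [Multiset.filter_cons_of_neg (p := fun e => e ≤ x) M h1]
      by_cases h2 : e ≤ x + 1
      · obtain rfl : e = x + 1 := by omega
        rw [Multiset.filter_cons_of_pos (p := fun e => e ≤ x + 1) M h2]
        simp only [Multiset.card_cons, Multiset.sum_cons]
        push_cast
        linarith
      · rw [Multiset.filter_cons_of_neg (p := fun e => e ≤ x + 1) M h2]
        exact ih

lemma exists_bound (M : Multiset ℤ) : ∃ B : ℤ, 0 ≤ B ∧ ∀ e ∈ M, -B ≤ e ∧ e ≤ B := by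
  induction M using Multiset.induction with
  | empty => exact ⟨0, le_rfl, by simp⟩
  | cons e M ih =>
    obtain ⟨B, h0, hB⟩ := ih
    refine ⟨B + |e|, by positivity, fun f hf => ?_⟩
    have h1 := abs_le.1 (le_refl |e|)
    have h2 := abs_nonneg e
    rcases Multiset.mem_cons.1 hf with rfl | hf
    · omega
    · have := hB f hf
      omega

lemma exists_sign_change (f : ℤ → ℤ) {lo : ℤ} (k : ℕ) (hlo : 0 ≤ f lo)
    (hhi : f (lo + (k + 1 : ℕ)) ≤ 0) : ∃ x, 0 ≤ f x ∧ f (x + 1) ≤ 0 := by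
  induction k with
  | zero => exact ⟨lo, hlo, by simpa using hhi⟩
  | succ k ih =>
    by_cases h : f (lo + (k + 1 : ℕ)) ≤ 0
    · exact ih h
    · exact ⟨lo + (k + 1 : ℕ), by omega, by convert hhi using 2; push_cast; ring⟩

/-- The line of slope `N` which ends at the total sum `T` meets the tail function of `M`. -/
lemma exists_crossing (M : Multiset ℤ) {N : ℕ} {T : ℤ} (hN : 0 < N) (hcard : M.card ≤ N)
    (hsum : M.card = N → T ≤ M.sum) :
    ∃ x : ℤ, N * x - T ≤ x * ((M.filter (· ≤ x)).card : ℤ) - (M.filter (· ≤ x)).sum ∧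
      (x + 1) * ((M.filter (· ≤ x)).card : ℤ) - (M.filter (· ≤ x)).sum ≤ N * (x + 1) - T := by
  obtain ⟨B, hB0, hB⟩ := exists_bound M
  have hT := abs_le.1 (le_refl |T|)
  have hT0 := abs_nonneg T
  have hR := abs_le.1 (le_refl |T - M.sum|)
  have hR0 := abs_nonneg (T - M.sum)
  set f : ℤ → ℤ := fun x =>
    x * ((M.filter (· ≤ x)).card : ℤ) - (M.filter (· ≤ x)).sum - (N * x - T) with hf
  -- Far to the left the tail function vanishes and the line is negative; far to the right the line
  -- has the larger slope, or the same slope and, by `hsum`, no smaller a value.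
  have hlo : 0 ≤ f (-B - |T| - 1) := by
    have : M.filter (· ≤ -B - |T| - 1) = 0 := by
      rw [Multiset.filter_eq_nil]
      intro e he
      have := hB e he
      omega
    simp only [hf, this, Multiset.card_zero, Multiset.sum_zero]
    have h3 : (0 : ℤ) ≤ ((N : ℤ) - 1) * (B + |T| + 1) := mul_nonneg (by omega) (by omega)
    push_cast
    linarith
  have hhi : f (B + |T - M.sum| + 1) ≤ 0 := by
    have : M.filter (· ≤ B + |T - M.sum| + 1) = M := by
      rw [Multiset.filter_eq_self]
      intro e he
      have := hB e he
      omega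
    simp only [hf, this]
    rcases hcard.lt_or_eq with hlt | heq
    · have h3 : (0 : ℤ) ≤ ((N : ℤ) - M.card - 1) * (B + |T - M.sum| + 1) :=
        mul_nonneg (by omega) (by omega)
      linarith
    · have := hsum heq
      rw [heq]
      linarith
  obtain ⟨t, ht⟩ : ∃ t : ℕ, -B - |T| - 1 + ((t + 1 : ℕ) : ℤ) = B + |T - M.sum| + 1 :=
    ⟨(2 * B + |T| + 1 + |T - M.sum|).toNat, by
      rw [Nat.cast_add, Int.toNat_of_nonneg (by omega)]
      push_cast
      ring⟩
  obtain ⟨x, h1, h2⟩ := exists_sign_change f t hlo (by rwa [ht])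
  have := tail_succ M x
  simp only [hf] at h1 h2
  exact ⟨x, by linarith, by linarith⟩

lemma filter_replicate_of_le (t : ℕ) {y w : ℤ} (h : y ≤ w) :
    (Multiset.replicate t y).filter (· ≤ w) = Multiset.replicate t y :=
  Multiset.filter_eq_self.2 fun _ he => (Multiset.eq_of_mem_replicate he).le.trans h

lemma filter_replicate_of_lt (t : ℕ) {y w : ℤ} (h : w < y) :
    (Multiset.replicate t y).filter (· ≤ w) = 0 :=
  Multiset.filter_eq_nil.2 fun _ he => not_le.2 (h.trans_eq (Multiset.eq_of_mem_replicate he).symm)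

/-- A partition with given length and sum which agrees with `M` below some level `x`, and all of
whose other entries are `x` or `x + 1`. -/
lemma exists_flattened (M : Multiset ℤ) {N : ℕ} {T : ℤ} (hN : 0 < N) (hcard : M.card ≤ N)
    (hsum : M.card = N → T ≤ M.sum) :
    ∃ g : Fin N → ℤ, Antitone g ∧ ∑ i, g i = T ∧ ∃ x : ℤ,
      (∀ w < x, cnt g w = (M.filter (· ≤ w)).card ∧
        lowSum g (cnt g w) = (M.filter (· ≤ w)).sum) ∧
      ((M.filter (· ≤ x)).card ≤ cnt g x ∧
        lowSum g (cnt g x) = (M.filter (· ≤ x)).sum +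
          ((cnt g x : ℤ) - (M.filter (· ≤ x)).card) * x ∧
        T = lowSum g (cnt g x) + ((N : ℤ) - cnt g x) * (x + 1)) ∧
      ∀ w, x < w → cnt g w = N := by
  obtain ⟨x, h1, h2⟩ := exists_crossing M hN hcard hsum
  set ρ := (M.filter (· ≤ x)).card with hρ
  set σ := (M.filter (· ≤ x)).sum with hσ
  -- `r` solves `σ + (r - ρ) x + (N - r) (x + 1) = T`; the two crossing inequalities give `ρ ≤ r ≤
  -- N`.
  obtain ⟨r, hr⟩ : ∃ r : ℕ, (r : ℤ) = N * (x + 1) - T - (x * ρ - σ) :=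
    ⟨(N * (x + 1) - T - (x * ρ - σ)).toNat, Int.toNat_of_nonneg (by
      have : (0 : ℤ) ≤ ρ := Int.natCast_nonneg _
      linarith)⟩
  have hρr : ρ ≤ r := by
    have : (ρ : ℤ) ≤ r := by linarith
    exact_mod_cast this
  have hrN : r ≤ N := by
    have : (r : ℤ) ≤ N := by linarith
    exact_mod_cast this
  obtain ⟨y, hy⟩ := Nat.exists_eq_add_of_le hρr
  obtain ⟨z, hz⟩ := Nat.exists_eq_add_of_le hrN
  set M' := M.filter (· ≤ x) + (Multiset.replicate y x + Multiset.replicate z (x + 1)) with hM'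
  have hc : M'.card = N := by
    rw [hM', Multiset.card_add, Multiset.card_add, Multiset.card_replicate,
      Multiset.card_replicate, ← hρ]
    omega
  have hsumM' : M'.sum = σ + y * x + z * (x + 1) := by
    simp only [hM', Multiset.sum_add, Multiset.sum_replicate, nsmul_eq_mul, ← hσ]
    ring
  have hT : T = σ + y * x + z * (x + 1) := by
    rw [hy] at hr
    rw [hz, hy] at hr
    push_cast at hr
    linarith
  obtain ⟨g, hg, hgM⟩ := exists_antitone_map_eq M' hc
  have hx : M'.filter (· ≤ x) = M.filter (· ≤ x) + Multiset.replicate y x := by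
    rw [hM', Multiset.filter_add, Multiset.filter_add, Multiset.filter_filter,
      filter_replicate_of_le y le_rfl, filter_replicate_of_lt z (by omega)]
    simp
  have hcx : cnt g x = r := by
    rw [cnt_eq_card_filter, hgM, hx, Multiset.card_add, Multiset.card_replicate, hy]
  have hlx : lowSum g (cnt g x) = σ + y * x := by
    rw [lowSum_cnt_eq_sum_filter hg, hgM, hx, Multiset.sum_add, Multiset.sum_replicate,
      nsmul_eq_mul]
  refine ⟨g, hg, ?_, x, fun w hw => ?_, ⟨by omega, ?_, ?_⟩, fun w hw => ?_⟩
  · have : ∑ i, g i = (Finset.univ.val.map g).sum := rfl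
    rw [this, hgM, hsumM', hT]
  · have : M'.filter (· ≤ w) = M.filter (· ≤ w) := by
      rw [hM', Multiset.filter_add, Multiset.filter_add, Multiset.filter_filter,
        filter_replicate_of_lt y hw, filter_replicate_of_lt z (by omega), add_zero, add_zero]
      apply Multiset.filter_congr
      intro e _
      omega
    rw [lowSum_cnt_eq_sum_filter hg, cnt_eq_card_filter, hgM, this]
    exact ⟨rfl, rfl⟩
  · rw [hlx, hcx, hy]
    push_cast
    ring
  · rw [hlx, hcx, hT, hz]
    push_cast
    ring
  · rw [cnt_eq_card_filter, hgM, Multiset.filter_eq_self.2, hc]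
    intro e he
    rw [hM', Multiset.mem_add, Multiset.mem_add] at he
    rcases he with he | he | he
    · have := (Multiset.mem_filter.1 he).2
      omega
    · rw [Multiset.eq_of_mem_replicate he]
      omega
    · rw [Multiset.eq_of_mem_replicate he]
      omega

/-- Below `x` nothing has changed, above `x` only the total sum matters, and at `x` the entries
interpolate between `M` and the full union. -/
lemma covers_of_flattened {m s N : ℕ} {d : Fin m → ℤ} {a : Fin s → ℤ} {g : Fin N → ℤ}
    {M : Multiset ℤ} {T x : ℤ} (hd : Antitone d) (ha : Antitone a) (hN : N = m + s)
    (hT : T = ∑ i, d i + ∑ i, a i) (hg : ∑ i, g i = T)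
    (hM : ∀ w, Covers d a (cnt d w) (M.filter (· ≤ w)).card (M.filter (· ≤ w)).sum)
    (hlow : ∀ w < x, cnt g w = (M.filter (· ≤ w)).card ∧
        lowSum g (cnt g w) = (M.filter (· ≤ w)).sum)
    (hx : (M.filter (· ≤ x)).card ≤ cnt g x ∧
        lowSum g (cnt g x) = (M.filter (· ≤ x)).sum +
          ((cnt g x : ℤ) - (M.filter (· ≤ x)).card) * x ∧
        T = lowSum g (cnt g x) + ((N : ℤ) - cnt g x) * (x + 1))
    (hhigh : ∀ w, x < w → cnt g w = N) (w : ℤ) :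
    Covers d a (cnt d w) (cnt g w) (lowSum g (cnt g w)) := by
  have htop : Covers d a (cnt d w) N T := by
    rw [hN, covers_top_iff (cnt_le d w), hT]
  rcases lt_trichotomy w x with hw | rfl | hw
  · obtain ⟨h1, h2⟩ := hlow w hw
    rw [h2, h1]
    exact hM w
  · obtain ⟨h1, h2, h3⟩ := hx
    exact (hM w).interpolate hd ha htop h1 (cnt_le g w) h2.ge h3.le
  · rw [hhigh w hw, lowSum_top, hg]
    exact htop

end Construction

end PartitionPairs

theorem theorem2 {m s n k : ℕ} (hm : 0 < m) (hs : 0 < s) (hn : 0 < n) (hk : 0 < k)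
    (hlen : m + s = n + k)
    (a : Fin s → ℤ) (d : Fin m → ℤ) (b : Fin k → ℤ) (c : Fin n → ℤ)
    (ha : Antitone a) (hd : Antitone d) (hb : Antitone b) (hc : Antitone c)
    (hcd : ∀ (i : Fin n) (j : Fin m), c i ≠ d j) :
    (∃ g : Fin (m + s) → ℤ, Antitone g ∧
        PartitionPairs.GenMajorized g d a ∧ PartitionPairs.GenMajorized g c b) ↔
      (∑ i, c i + ∑ i, b i = ∑ i, d i + ∑ i, a i) ∧
        PartitionPairs.Cond d a c
          (PartitionPairs.setΔ d a c b) (PartitionPairs.setS d a c b) ∧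
        PartitionPairs.Cond c b d
          (PartitionPairs.setS d a c b) (PartitionPairs.setΔ d a c b) := by
  open PartitionPairs in
  have hrun := run_sets (a := a) (b := b) hd hc hcd
  constructor
  · rintro ⟨g, hg, h₁, h₂⟩
    refine ⟨h₂.total_sum.symm.trans h₁.total_sum, ?_⟩
    exact (hrun.dominated hd ha hc hb hg hcd (fun w => h₁.covers hg hd w)
      (fun w => h₂.covers hg hc w)).2.1
  · rintro ⟨htot, hc₁, hc₂⟩
    obtain ⟨f₁, f₂⟩ := hrun.feasible hd ha hc hb hcd hc₁ hc₂
    set Δ := setΔ d a c b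
    set S := setS d a c b
    set M : Multiset ℤ := Δ.val.map d + S.val.map c with hM
    have hcard : M.card = Δ.card + S.card := by simp [hM]
    have hsum : M.sum = ∑ i ∈ Δ, d i + ∑ i ∈ S, c i := by
      rw [hM, Multiset.sum_add]
      rfl
    have hcardw : ∀ w, (M.filter (· ≤ w)).card
        = (Δ.filter fun i => d i ≤ w).card + (S.filter fun i => c i ≤ w).card := by
      intro w
      rw [hM, Multiset.filter_add, Multiset.filter_map, Multiset.filter_map, Multiset.card_add,
        Multiset.card_map, Multiset.card_map]
      rfl
    have hsumw : ∀ w, (M.filter (· ≤ w)).sum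
        = ∑ i ∈ Δ with d i ≤ w, d i + ∑ i ∈ S with c i ≤ w, c i := by
      intro w
      rw [hM, Multiset.filter_add, Multiset.filter_map, Multiset.filter_map, Multiset.sum_add]
      rfl
    -- If `M` already has full length, covering at that length bounds the total sum by the sum of
    -- `M`.
    obtain ⟨g, hg, hgT, x, hlow, hx, hhigh⟩ := exists_flattened M (N := m + s)
      (T := ∑ i, d i + ∑ i, a i) (by omega) (by rw [hcard]; exact f₁.1.le_length) (by
        intro h
        have h1 := f₁.1
        rw [← hcard, h, ← hsum, covers_top_iff le_rfl] at h1
        exact h1)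
    refine ⟨g, hg, ?_, ?_⟩
    · refine genMajorized_of_covers hg hd ha rfl hgT
        (covers_of_flattened hd ha rfl rfl hgT (fun w => ?_) hlow hx hhigh)
      rw [hcardw, hsumw]
      exact f₁.2 w (cnt_le d w) (cnt_le c w)
    · refine genMajorized_of_covers hg hc hb hlen (hgT.trans htot.symm)
        (covers_of_flattened hc hb hlen htot.symm hgT (fun w => ?_) hlow hx hhigh)
      rw [hcardw, hsumw, add_comm (Finset.card _), add_comm (Finset.sum _ _)]
      exact f₂.2 w (cnt_le c w) (cnt_le d w)
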